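/- Let $Q\to\mathbb R$ be a smooth ($C^\infty$) locally trivial fibre bundle whose typical fibre $M$ is a manifold of dimension $m$, with bundle coordinates $(t,q^i)$, where $t$ is the Cartesian coordinate of $\mathbb R$. Let $J^1Q$ be its first order jet manifold, with adapted coordinates $(t,q^i,q^i_t)$, identified with $\{v\in TQ : dt(v)=1\}$, and put $\partial_i=\partial/\partial q^i$, $\partial^t_i=\partial/\partial q^i_t$. Write $VJ^1Q$ and $V_QJ^1Q$ for the vertical tangent bundles of $J^1Q\to\mathbb R$ and of $J^1Q\to Q$. Summation over repeated indices is understood. A holonomic connection on $J^1Q\to\mathbb R$ is a connection with values in $J^2Q$, i.e. a smooth vector field on $J^1Q$ of the form $\xi=\partial_t+q^i_t\partial_i+\xi^i\partial^t_i$. A dynamic connection is a (smooth, in general nonlinear) connection on the affine jet bundle $J^1Q\to Q$, $$\gamma=dt\otimes(\partial_t+\gamma^i_0\partial^t_i)+dq^j\otimes(\partial_j+\gamma^i_j\partial^t_i).$$ It is called symmetric if $\gamma^k_i=\partial^t_i\gamma^k_0+q^j_t\,\partial^t_i\gamma^k_j$ in all bundle coordinates, and it defines the holonomic connection $\xi_\gamma=\partial_t+q^i_t\partial_i+(\gamma^i_0+q^j_t\gamma^i_j)\partial^t_i$.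 Let $\widehat v$ be the canonical endomorphism of $TJ^1Q$ with $\widehat v(\partial_t)=-q^i_t\partial^t_i$, $\widehat v(\partial_i)=\partial^t_i$, $\widehat v(\partial^t_i)=0$. Then the following hold. 1. Every holonomic connection $\xi$ on $J^1Q\to\mathbb R$ yields a dynamic connection $\gamma_\xi$ on $J^1Q\to Q$, given in all bundle coordinates by $$\gamma_\xi=dt\otimes\bigl[\partial_t+(\xi^i-\tfrac12 q^j_t\,\partial^t_j\xi^i)\,\partial^t_i\bigr]+dq^j\otimes\bigl[\partial_j+\tfrac12\,\partial^t_j\xi^i\,\partial^t_i\bigr].$$ 2. There is a unique fibrewise linear endomorphism $I_\xi$ of $VJ^1Q$ over the identity such that $I_\xi(u)=[\xi,\widehat v(u)]-\widehat v([\xi,u])$ for all local smooth sections $u$ of $VJ^1Q$. With $J_\xi=\tfrac12(I_\xi+\mathrm{Id})$ and $\widehat\xi:TJ^1Q\to VJ^1Q$, $\widehat\xi(w)=w-dt(w)\,\xi$, the projection of $TJ^1Q$ onto $V_QJ^1Q$ along the horizontal subbundle of $\gamma_\xi$ is $J_\xi\circ\widehat\xi$. 3. The dynamic connection $\gamma_\xi$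 is symmetric. 4. A dynamic connection $\gamma$ satisfies $\gamma=\gamma_{\xi_\gamma}$ if and only if $\gamma$ is symmetric. -/

import Mathlib

open Set Filter Topology Bundle
open scoped Manifold ContDiff

noncomputable section

namespace TimeMech

/-- The model of the fibre. -/
abbrev Fib (m : ℕ) : Type := EuclideanSpace ℝ (Fin m)

/-- The coordinate space of `(t, q^i)`. -/
abbrev Base (m : ℕ) : Type := ℝ × Fib m

/-- The coordinate space of `(t, q^i, q^i_t)`. -/
abbrev Jet (m : ℕ) : Type := (ℝ × Fib m) × Fib m

/-- A smooth locally trivial fibre bundle `Q → ℝ` with typical fibre the `m`-dimensional smooth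
manifold `M`. -/
structure TimeBundle (m : ℕ)
    (M : Type*) [TopologicalSpace M] [ChartedSpace (Fib m) M] [IsManifold 𝓘(ℝ, Fib m) ∞ M]
    (Q : Type*) [TopologicalSpace Q] [ChartedSpace (Base m) Q] [IsManifold 𝓘(ℝ, Base m) ∞ Q] where
  /-- the projection onto the time axis -/
  proj : Q → ℝ
  locallyTrivial : ∀ t : ℝ, ∃ U : Set ℝ, IsOpen U ∧ t ∈ U ∧
    ∃ Φ : OpenPartialHomeomorph Q (ℝ × M),
      Φ.source = proj ⁻¹' U ∧ Φ.target = U ×ˢ univ ∧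
      (∀ q ∈ Φ.source, (Φ q).1 = proj q) ∧
      ContMDiffOn 𝓘(ℝ, Base m) (𝓘(ℝ, ℝ).prod 𝓘(ℝ, Fib m)) ∞ Φ Φ.source ∧
      ContMDiffOn (𝓘(ℝ, ℝ).prod 𝓘(ℝ, Fib m)) 𝓘(ℝ, Base m) ∞ Φ.symm Φ.target

variable {m : ℕ}
  {M : Type*} [TopologicalSpace M] [ChartedSpace (Fib m) M] [IsManifold 𝓘(ℝ, Fib m) ∞ M]
  {Q : Type*} [TopologicalSpace Q] [ChartedSpace (Base m) Q] [IsManifold 𝓘(ℝ, Base m) ∞ Q]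

/-- Bundle coordinates `(t, q^i)` on an open subset of `Q`: smooth coordinates whose first
component is the time. -/
structure BundleChart (B : TimeBundle m M Q) where
  /-- the coordinate map -/
  coord : OpenPartialHomeomorph Q (Base m)
  fst_eq : ∀ q ∈ coord.source, (coord q).1 = B.proj q
  smooth : ContMDiffOn 𝓘(ℝ, Base m) 𝓘(ℝ, Base m) ∞ coord coord.source
  smooth_symm : ContMDiffOn 𝓘(ℝ, Base m) 𝓘(ℝ, Base m) ∞ coord.symm coord.target

/-- The differential of the projection `Q → ℝ`, i.e. the 1-form `dt` on `Q`. -/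
def dtQ (B : TimeBundle m M Q) (q : Q) : TangentSpace 𝓘(ℝ, Base m) q →L[ℝ] ℝ :=
  mfderiv 𝓘(ℝ, Base m) 𝓘(ℝ, ℝ) B.proj q

/-- The first order jet manifold `J¹Q` of sections of `Q → ℝ`, identified with its canonical image
in `TQ`: the jet of a section `s` at `t` is its velocity `s'(t)`, and these velocities are the
tangent vectors `v` with `dt(v) = 1`. -/
@[ext]
structure J1 (B : TimeBundle m M Q) where
  /-- the underlying tangent vector, i.e. the canonical imbedding `J¹Q → TQ` -/
  val : TangentBundle 𝓘(ℝ, Base m) Q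
  property : dtQ B val.1 val.2 = 1

variable {B : TimeBundle m M Q}

/-- The topology of a subspace of `TQ`. -/
instance : TopologicalSpace (J1 B) := TopologicalSpace.induced J1.val inferInstance

lemma continuous_val : Continuous (J1.val : J1 B → TangentBundle 𝓘(ℝ, Base m) Q) :=
  continuous_induced_dom

/-- The projection `J¹Q → Q`. -/
def jetProj (B : TimeBundle m M Q) (z : J1 B) : Q := z.val.1

/-- The projection `J¹Q → ℝ`. -/
def jetTime (B : TimeBundle m M Q) (z : J1 B) : ℝ := B.proj (jetProj B z)

/-- The point `z` of `J¹Q`, regarded as a tangent vector to `Q`. -/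
def vel (z : J1 B) : TangentSpace 𝓘(ℝ, Base m) (jetProj B z) := z.val.2

lemma dtQ_vel (z : J1 B) : dtQ B (jetProj B z) (vel z) = 1 := z.property

section Coordinates

lemma exists_bundleChart (B : TimeBundle m M Q) (q : Q) :
    ∃ φ : BundleChart B, q ∈ φ.coord.source := by
  obtain ⟨U, hU, ht, Φ, hs, htar, hfst, hsm, hsm'⟩ := B.locallyTrivial (B.proj q)
  let c : OpenPartialHomeomorph (ℝ × M) (ℝ × Fib m) :=
    (OpenPartialHomeomorph.refl ℝ).prod (chartAt (Fib m) (Φ q).2)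
  have hc : ContMDiffOn (𝓘(ℝ, ℝ).prod 𝓘(ℝ, Fib m)) 𝓘(ℝ, Base m) ∞ c c.source := by
    rw [modelWithCornersSelf_prod, ← chartedSpaceSelf_prod]
    exact contMDiffOn_id.prodMap (contMDiffOn_chart (I := 𝓘(ℝ, Fib m)))
  have hc' : ContMDiffOn 𝓘(ℝ, Base m) (𝓘(ℝ, ℝ).prod 𝓘(ℝ, Fib m)) ∞ c.symm c.target := by
    rw [modelWithCornersSelf_prod, ← chartedSpaceSelf_prod]
    exact contMDiffOn_id.prodMap (contMDiffOn_chart_symm (I := 𝓘(ℝ, Fib m)))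
  refine ⟨⟨Φ.trans c, ?_, ?_, ?_⟩, ?_⟩
  · intro x hx
    exact hfst x hx.1
  · exact hc.comp (hsm.mono fun x hx => hx.1) (fun x hx => hx.2)
  · have hsub : (Φ.trans c).target ⊆ c.target := fun x hx => hx.1
    exact hsm'.comp (hc'.mono hsub) (fun x hx => hx.2)
  · have : q ∈ Φ.source := by rw [hs]; exact ht
    refine ⟨this, ?_⟩
    simp [c]

lemma BundleChart.mdiff (φ : BundleChart B) {q : Q} (hq : q ∈ φ.coord.source) :
    MDifferentiableAt 𝓘(ℝ, Base m) 𝓘(ℝ, Base m) φ.coord q :=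
  (φ.smooth.contMDiffAt (φ.coord.open_source.mem_nhds hq)).mdifferentiableAt (by simp)

lemma BundleChart.mdiff_symm (φ : BundleChart B) {x : Base m} (hx : x ∈ φ.coord.target) :
    MDifferentiableAt 𝓘(ℝ, Base m) 𝓘(ℝ, Base m) φ.coord.symm x :=
  (φ.smooth_symm.contMDiffAt (φ.coord.open_target.mem_nhds hx)).mdifferentiableAt (by simp)

lemma contMDiff_proj (B : TimeBundle m M Q) :
    ContMDiff 𝓘(ℝ, Base m) 𝓘(ℝ, ℝ) ∞ B.proj := by
  intro q
  obtain ⟨φ, hq⟩ := exists_bundleChart B q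
  have h := φ.smooth.contMDiffAt (φ.coord.open_source.mem_nhds hq)
  have h2 : ContMDiffAt 𝓘(ℝ, Base m) 𝓘(ℝ, ℝ) ∞ (fun p => (φ.coord p).1) q :=
    contDiff_fst.contMDiff.contMDiffAt.comp q h
  refine h2.congr_of_eventuallyEq ?_
  filter_upwards [φ.coord.open_source.mem_nhds hq] with p hp
  exact (φ.fst_eq p hp).symm

/-- The differential of a bundle chart. -/
def BundleChart.d (φ : BundleChart B) (q : Q) : TangentSpace 𝓘(ℝ, Base m) q →L[ℝ] Base m :=
  mfderiv 𝓘(ℝ, Base m) 𝓘(ℝ, Base m) φ.coord q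

/-- The differential of the inverse of a bundle chart. -/
def BundleChart.dsymm (φ : BundleChart B) (x : Base m) :
    Base m →L[ℝ] TangentSpace 𝓘(ℝ, Base m) (φ.coord.symm x) :=
  mfderiv 𝓘(ℝ, Base m) 𝓘(ℝ, Base m) φ.coord.symm x

lemma BundleChart.d_dsymm (φ : BundleChart B) {x : Base m} (hx : x ∈ φ.coord.target)
    (w : Base m) : φ.d (φ.coord.symm x) (φ.dsymm x w) = w := by
  have h := mfderiv_comp x (φ.mdiff (φ.coord.map_target hx)) (φ.mdiff_symm hx)
  have h2 : mfderiv 𝓘(ℝ, Base m) 𝓘(ℝ, Base m) (φ.coord ∘ φ.coord.symm) x =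
      ContinuousLinearMap.id ℝ _ := by
    rw [← mfderiv_id]
    refine Filter.EventuallyEq.mfderiv_eq ?_
    filter_upwards [φ.coord.open_target.mem_nhds hx] with y hy
    exact φ.coord.right_inv hy
  rw [h2] at h
  exact (DFunLike.congr_fun h w).symm

lemma BundleChart.dsymm_d (φ : BundleChart B) {q : Q} (hq : q ∈ φ.coord.source)
    (v : TangentSpace 𝓘(ℝ, Base m) q) : φ.dsymm (φ.coord q) (φ.d q v) = v := by
  have h := mfderiv_comp q (φ.mdiff_symm (φ.coord.map_source hq)) (φ.mdiff hq)
  have h2 : mfderiv 𝓘(ℝ, Base m) 𝓘(ℝ, Base m) (φ.coord.symm ∘ φ.coord) q =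
      ContinuousLinearMap.id ℝ _ := by
    rw [← mfderiv_id]
    refine Filter.EventuallyEq.mfderiv_eq ?_
    filter_upwards [φ.coord.open_source.mem_nhds hq] with y hy
    exact φ.coord.left_inv hy
  rw [h2] at h
  exact (DFunLike.congr_fun h v).symm

lemma BundleChart.d_fst (φ : BundleChart B) {q : Q} (hq : q ∈ φ.coord.source)
    (v : TangentSpace 𝓘(ℝ, Base m) q) : (φ.d q v).1 = dtQ B q v := by
  have h1 : MDifferentiableAt 𝓘(ℝ, Base m) 𝓘(ℝ, ℝ) (Prod.fst : Base m → ℝ) (φ.coord q) :=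
    differentiableAt_fst.mdifferentiableAt
  have h := mfderiv_comp q h1 (φ.mdiff hq)
  have h2 : mfderiv 𝓘(ℝ, Base m) 𝓘(ℝ, ℝ) (Prod.fst ∘ φ.coord) q =
      mfderiv 𝓘(ℝ, Base m) 𝓘(ℝ, ℝ) B.proj q := by
    refine Filter.EventuallyEq.mfderiv_eq ?_
    filter_upwards [φ.coord.open_source.mem_nhds hq] with y hy
    exact φ.fst_eq y hy
  rw [h2, mfderiv_eq_fderiv, fderiv_fst] at h
  exact (DFunLike.congr_fun h v).symm

lemma BundleChart.dtQ_dsymm (φ : BundleChart B) {x : Base m} (hx : x ∈ φ.coord.target)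
    (w : Base m) : dtQ B (φ.coord.symm x) (φ.dsymm x w) = w.1 := by
  rw [← φ.d_fst (φ.coord.map_target hx), φ.d_dsymm hx]

lemma BundleChart.nonempty_J1 (φ : BundleChart B) : Nonempty (J1 B) := by
  obtain ⟨ψ, hψ⟩ := exists_bundleChart B (φ.coord.symm 0)
  exact ⟨⟨⟨_, ψ.dsymm (ψ.coord (φ.coord.symm 0)) (1, 0)⟩,
    ψ.dtQ_dsymm (ψ.coord.map_source hψ) (1, 0)⟩⟩

open Classical in
/-- The point of `J¹Q` with coordinates `(t, q^i, q^i_t)`. -/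
def BundleChart.ofCoord (φ : BundleChart B) (x : Jet m) : J1 B :=
  if h : dtQ B (φ.coord.symm x.1) (φ.dsymm x.1 (1, x.2)) = 1 then
    ⟨⟨φ.coord.symm x.1, φ.dsymm x.1 (1, x.2)⟩, h⟩ else φ.nonempty_J1.some

lemma BundleChart.ofCoord_val (φ : BundleChart B) {x : Jet m} (hx : x.1 ∈ φ.coord.target) :
    (φ.ofCoord x).1 = ⟨φ.coord.symm x.1, φ.dsymm x.1 (1, x.2)⟩ := by
  have h : dtQ B (φ.coord.symm x.1) (φ.dsymm x.1 (1, x.2)) = 1 := φ.dtQ_dsymm hx _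
  exact congrArg J1.val (dif_pos h)

/-- The coordinates `(t, q^i, q^i_t)` on `J¹Q` adapted to bundle coordinates `(t, q^i)` on `Q`. -/
def BundleChart.jetChart (φ : BundleChart B) : OpenPartialHomeomorph (J1 B) (Jet m) where
  toFun z := (φ.coord (jetProj B z), (φ.d (jetProj B z) (vel z)).2)
  invFun := φ.ofCoord
  source := jetProj B ⁻¹' φ.coord.source
  target := φ.coord.target ×ˢ univ
  map_source' z hz := ⟨φ.coord.map_source hz, mem_univ _⟩
  map_target' x hx := by
    change (φ.ofCoord x).1.1 ∈ φ.coord.source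
    rw [φ.ofCoord_val hx.1]
    exact φ.coord.map_target hx.1
  left_inv' z hz := by
    have hz : z.1.1 ∈ φ.coord.source := hz
    apply J1.ext
    rw [φ.ofCoord_val (φ.coord.map_source hz)]
    have h1 : ((1 : ℝ), (φ.d (jetProj B z) (vel z)).2) = φ.d (jetProj B z) (vel z) :=
      Prod.ext ((φ.d_fst hz (vel z)).trans (dtQ_vel z)).symm rfl
    refine Bundle.TotalSpace.ext (φ.coord.left_inv hz) ?_
    refine heq_of_eq ?_
    change φ.dsymm (φ.coord (jetProj B z)) ((1 : ℝ), (φ.d (jetProj B z) (vel z)).2) = vel z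
    rw [h1]
    exact φ.dsymm_d hz _
  right_inv' x hx := by
    have key : ∀ v : TangentBundle 𝓘(ℝ, Base m) Q,
        v = ⟨φ.coord.symm x.1, φ.dsymm x.1 (1, x.2)⟩ →
        ((φ.coord v.1, (φ.d v.1 v.2).2) : Jet m) = x := by
      rintro v rfl
      refine Prod.ext (φ.coord.right_inv hx.1) ?_
      exact congrArg (Prod.snd : Base m → Fib m) (φ.d_dsymm hx.1 (1, x.2))
    exact key _ (φ.ofCoord_val hx.1)
  open_source := by
    have : Continuous (jetProj B) :=
      (FiberBundle.continuous_proj (Base m) (TangentSpace 𝓘(ℝ, Base m))).comp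
        continuous_val
    exact φ.coord.open_source.preimage this
  open_target := φ.coord.open_target.prod isOpen_univ
  continuousOn_toFun := by
    have hp : Continuous (jetProj B) :=
      (FiberBundle.continuous_proj (Base m) (TangentSpace 𝓘(ℝ, Base m))).comp
        continuous_val
    refine (φ.coord.continuousOn.comp hp.continuousOn (fun z hz => hz)).prodMk ?_
    have h1 := φ.smooth.continuousOn_tangentMapWithin (by simp)
      φ.coord.open_source.uniqueMDiffOn
    have h2 : ContinuousOn
        (fun v : TangentBundle 𝓘(ℝ, Base m) Q => (φ.d v.1 v.2).2)
        (TotalSpace.proj ⁻¹' φ.coord.source) := by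
      have h3 := (continuous_snd.comp (contMDiff_snd_tangentBundle_modelSpace (n := 1)
        (Base m) 𝓘(ℝ, Base m)).continuous).comp_continuousOn h1
      refine h3.congr ?_
      intro v hv
      change _ = (mfderivWithin 𝓘(ℝ, Base m) 𝓘(ℝ, Base m) φ.coord φ.coord.source v.1 v.2).2
      rw [mfderivWithin_of_isOpen φ.coord.open_source hv]
      rfl
    exact h2.comp continuous_val.continuousOn (fun z hz => hz)
  continuousOn_invFun := by
    have h1 := φ.smooth_symm.continuousOn_tangentMapWithin (by simp)
      φ.coord.open_target.uniqueMDiffOn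
    have h2 : Continuous (fun x : Jet m =>
        (⟨x.1, ((1 : ℝ), x.2)⟩ : TangentBundle 𝓘(ℝ, Base m) (Base m))) :=
      (tangentBundleModelSpaceHomeomorph 𝓘(ℝ, Base m)).symm.continuous.comp
        (f := fun x : Jet m => ((x.1, ((1 : ℝ), x.2)) : ModelProd (Base m) (Base m)))
        (continuous_fst.prodMk (continuous_const.prodMk continuous_snd))
    have h3 := h1.comp (t := TotalSpace.proj ⁻¹' φ.coord.target) h2.continuousOn
      (s := φ.coord.target ×ˢ univ) (fun x hx => hx.1)
    have h4 : ContinuousOn (J1.val ∘ φ.ofCoord) (φ.coord.target ×ˢ univ) := by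
      refine h3.congr fun x hx => ?_
      change (φ.ofCoord x).val = ⟨φ.coord.symm x.1,
        mfderivWithin 𝓘(ℝ, Base m) 𝓘(ℝ, Base m) φ.coord.symm φ.coord.target x.1 (1, x.2)⟩
      rw [mfderivWithin_of_isOpen φ.coord.open_target hx.1]
      exact φ.ofCoord_val hx.1
    exact (Topology.IsInducing.induced J1.val).continuousOn_iff.2 h4

lemma BundleChart.jetChart_symm_val (φ : BundleChart B) {x : Jet m}
    (hx : x.1 ∈ φ.coord.target) :
    (φ.jetChart.symm x).val = ⟨φ.coord.symm x.1, φ.dsymm x.1 (1, x.2)⟩ :=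
  φ.ofCoord_val hx

lemma BundleChart.contDiffOn_trans (φ φ' : BundleChart B) :
    ContDiffOn ℝ ∞ (φ'.jetChart ∘ φ.jetChart.symm) (φ.jetChart.symm.trans φ'.jetChart).source := by
  set S : Set (Base m) := (φ.coord.symm.trans φ'.coord).source with hS
  have hSo : IsOpen S := (φ.coord.symm.trans φ'.coord).open_source
  set τ : Base m → Base m := φ'.coord ∘ φ.coord.symm with hτ
  have hτs : ContDiffOn ℝ ∞ τ S := by
    rw [← contMDiffOn_iff_contDiffOn]
    exact φ'.smooth.comp (φ.smooth_symm.mono fun x hx => hx.1) (fun x hx => hx.2)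
  have hsub : ∀ x ∈ (φ.jetChart.symm.trans φ'.jetChart).source, x.1 ∈ S := by
    intro x hx
    refine ⟨hx.1.1, ?_⟩
    have h2 : (φ.jetChart.symm x).val.1 ∈ φ'.coord.source := hx.2
    rw [φ.jetChart_symm_val hx.1.1] at h2
    exact h2
  have hd : ContDiffOn ℝ ∞ (fun x : Jet m => (τ x.1, (fderiv ℝ τ x.1 (1, x.2)).2))
      (φ.jetChart.symm.trans φ'.jetChart).source := by
    have h1 : ContDiffOn ℝ ∞ (fun x : Jet m => fderiv ℝ τ x.1)
        (φ.jetChart.symm.trans φ'.jetChart).source :=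
      (hτs.fderiv_of_isOpen hSo (m := ∞) (by simp)).comp contDiff_fst.contDiffOn hsub
    have h2 : ContDiffOn ℝ ∞ (fun x : Jet m => τ x.1)
        (φ.jetChart.symm.trans φ'.jetChart).source :=
      hτs.comp contDiff_fst.contDiffOn hsub
    exact h2.prodMk (contDiff_snd.comp_contDiffOn
      (h1.clm_apply (contDiff_const.prodMk contDiff_snd).contDiffOn))
  refine hd.congr fun x hx => ?_
  have hxS := hsub x hx
  have key : ∀ v : TangentBundle 𝓘(ℝ, Base m) Q,
      v = ⟨φ.coord.symm x.1, φ.dsymm x.1 (1, x.2)⟩ →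
      ((φ'.coord v.1, (φ'.d v.1 v.2).2) : Jet m) = (τ x.1, (fderiv ℝ τ x.1 (1, x.2)).2) := by
    rintro v rfl
    refine Prod.ext rfl ?_
    have h := mfderiv_comp x.1 (φ'.mdiff hxS.2) (φ.mdiff_symm hxS.1)
    rw [mfderiv_eq_fderiv] at h
    exact congrArg (Prod.snd : Base m → Fib m) (DFunLike.congr_fun h (1, x.2)).symm
  exact key _ (φ.jetChart_symm_val hx.1.1)

end Coordinates

/-- The smooth atlas of `J¹Q` made of all charts `(t, q^i, q^i_t)`. -/
instance : ChartedSpace (Jet m) (J1 B) where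
  atlas := {e | ∃ φ : BundleChart B, e = φ.jetChart}
  chartAt z := (exists_bundleChart B (jetProj B z)).choose.jetChart
  mem_chart_source z := (exists_bundleChart B (jetProj B z)).choose_spec
  chart_mem_atlas _ := ⟨_, rfl⟩

instance : IsManifold 𝓘(ℝ, Jet m) ∞ (J1 B) := by
  refine isManifold_of_contDiffOn _ _ _ ?_
  rintro e e' ⟨φ, rfl⟩ ⟨φ', rfl⟩
  simpa using φ.contDiffOn_trans φ'

lemma BundleChart.jetChart_mem (φ : BundleChart B) : φ.jetChart ∈ atlas (Jet m) (J1 B) :=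
  ⟨φ, rfl⟩

lemma BundleChart.contMDiffOn_jetChart (φ : BundleChart B) :
    ContMDiffOn 𝓘(ℝ, Jet m) 𝓘(ℝ, Jet m) ∞ φ.jetChart φ.jetChart.source :=
  contMDiffOn_of_mem_maximalAtlas (IsManifold.subset_maximalAtlas φ.jetChart_mem)

lemma BundleChart.contMDiffOn_jetChart_symm (φ : BundleChart B) :
    ContMDiffOn 𝓘(ℝ, Jet m) 𝓘(ℝ, Jet m) ∞ φ.jetChart.symm φ.jetChart.target :=
  contMDiffOn_symm_of_mem_maximalAtlas (IsManifold.subset_maximalAtlas φ.jetChart_mem)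

lemma contMDiff_jetProj (B : TimeBundle m M Q) :
    ContMDiff 𝓘(ℝ, Jet m) 𝓘(ℝ, Base m) ∞ (jetProj B) := by
  intro z
  obtain ⟨φ, hq⟩ := exists_bundleChart B (jetProj B z)
  have h := φ.contMDiffOn_jetChart.contMDiffAt (φ.jetChart.open_source.mem_nhds hq)
  have h2 : ContMDiffAt 𝓘(ℝ, Jet m) 𝓘(ℝ, Base m) ∞ (fun y => (φ.jetChart y).1) z :=
    contDiff_fst.contMDiff.contMDiffAt.comp z h
  have h3 := (φ.smooth_symm.contMDiffAt
    (φ.coord.open_target.mem_nhds (φ.coord.map_source hq))).comp z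
    (f := fun y => (φ.jetChart y).1) h2
  refine h3.congr_of_eventuallyEq ?_
  filter_upwards [φ.jetChart.open_source.mem_nhds hq] with p hp
  exact (φ.coord.left_inv hp).symm

/-- The tangent space of `J¹Q`. -/
abbrev TJ (z : J1 B) : Type := TangentSpace 𝓘(ℝ, Jet m) z

/-- The tangent map of `J¹Q → Q`. -/
def dProj (z : J1 B) : TJ z →L[ℝ] TangentSpace 𝓘(ℝ, Base m) (jetProj B z) :=
  mfderiv 𝓘(ℝ, Jet m) 𝓘(ℝ, Base m) (jetProj B) z

/-- The tangent map of `J¹Q → ℝ`, i.e. the 1-form `dt` on `J¹Q`. -/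
def dtJ (z : J1 B) : TJ z →L[ℝ] ℝ :=
  mfderiv 𝓘(ℝ, Jet m) 𝓘(ℝ, ℝ) (jetTime B) z

lemma contMDiff_jetTime (B : TimeBundle m M Q) :
    ContMDiff 𝓘(ℝ, Jet m) 𝓘(ℝ, ℝ) ∞ (jetTime B) :=
  (contMDiff_proj B).comp (contMDiff_jetProj B)

lemma dtJ_eq (z : J1 B) (w : TJ z) : dtJ z w = dtQ B (jetProj B z) (dProj z w) :=
  DFunLike.congr_fun (mfderiv_comp z ((contMDiff_proj B).mdifferentiableAt (by simp))
    ((contMDiff_jetProj B).mdifferentiableAt (by simp))) w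

section Connections

/-- A (smooth, in general nonlinear) connection on a fibred manifold `f : Y → X`, i.e. a smooth
section of the jet bundle `J¹Y → Y` of `f`, given by its horizontal lift
`T_{f y} X → T_y Y`, a right inverse of the tangent map of `f`. Smoothness is that of the
corresponding horizontal projection `TY → TY`. -/
@[ext]
structure Connection {E H E' H' : Type*}
    [NormedAddCommGroup E] [NormedSpace ℝ E] [TopologicalSpace H] (I : ModelWithCorners ℝ E H)
    [NormedAddCommGroup E'] [NormedSpace ℝ E'] [TopologicalSpace H'] (I' : ModelWithCorners ℝ E' H')
    {Y X : Type*} [TopologicalSpace Y] [ChartedSpace H Y] [IsManifold I ∞ Y]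
    [TopologicalSpace X] [ChartedSpace H' X] [IsManifold I' ∞ X] (f : Y → X) where
  /-- the horizontal lift -/
  lift : ∀ y : Y, TangentSpace I' (f y) →L[ℝ] TangentSpace I y
  mfderiv_lift : ∀ (y : Y) (v : TangentSpace I' (f y)), mfderiv I I' f y (lift y v) = v
  smooth : ContMDiff I.tangent I.tangent ∞
    (fun w : TangentBundle I Y => (⟨w.1, lift w.1 (mfderiv I I' f w.1 w.2)⟩ : TangentBundle I Y))

/-- A dynamic connection: a connection on the affine jet bundle `J¹Q → Q`. -/
abbrev DynamicConnection (B : TimeBundle m M Q) :=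
  Connection 𝓘(ℝ, Jet m) 𝓘(ℝ, Base m) (jetProj B)

/-- A connection on the jet bundle `J¹Q → ℝ`. -/
abbrev TimeConnection (B : TimeBundle m M Q) :=
  Connection 𝓘(ℝ, Jet m) 𝓘(ℝ, ℝ) (jetTime B)

/-- The vector field on `J¹Q` which represents a connection on `J¹Q → ℝ`: the horizontal lift of
the standard vector field `∂_t` on `ℝ`. -/
def TimeConnection.field (ξ : TimeConnection B) (z : J1 B) : TJ z := ξ.lift z (1 : ℝ)

/-- A connection on `J¹Q → ℝ` is holonomic if it takes its values in `J²Q`, which is the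
subbundle of `J¹J¹Q` where the two projections `J¹J¹Q → J¹Q` agree (in coordinates
`q^i_(t) = q^i_t`): the tangent map of `J¹Q → Q` sends the vector `ξ(z)` to `z`. -/
def TimeConnection.IsHolonomic (ξ : TimeConnection B) : Prop :=
  ∀ z : J1 B, dProj z (ξ.field z) = vel z

/-- A holonomic connection on `J¹Q → ℝ`. -/
abbrev HolonomicConnection (B : TimeBundle m M Q) :=
  {ξ : TimeConnection B // ξ.IsHolonomic}

/-- The vector field of a holonomic connection. -/
def HolonomicConnection.field (ξ : HolonomicConnection B) (z : J1 B) : TJ z := ξ.1.field z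

lemma HolonomicConnection.dtJ_field (ξ : HolonomicConnection B) (z : J1 B) :
    dtJ z (ξ.field z) = 1 := ξ.1.mfderiv_lift z (1 : ℝ)

lemma BundleChart.dProj_symm (φ : BundleChart B) {x : Jet m} (hx : x ∈ φ.jetChart.target)
    (a : Jet m) :
    (dProj (φ.jetChart.symm x) (mfderiv 𝓘(ℝ, Jet m) 𝓘(ℝ, Jet m) φ.jetChart.symm x a) : Base m) =
      (φ.dsymm x.1 a.1 : Base m) := by
  have hψ : MDifferentiableAt 𝓘(ℝ, Jet m) 𝓘(ℝ, Jet m) φ.jetChart.symm x :=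
    (φ.contMDiffOn_jetChart_symm.contMDiffAt
      (φ.jetChart.open_target.mem_nhds hx)).mdifferentiableAt (by simp)
  have h1 := mfderiv_comp x
    ((contMDiff_jetProj B).mdifferentiableAt (x := φ.jetChart.symm x) (by simp)) hψ
  have hfst : MDifferentiableAt 𝓘(ℝ, Jet m) 𝓘(ℝ, Base m) (Prod.fst : Jet m → Base m) x :=
    differentiableAt_fst.mdifferentiableAt
  have h2 := mfderiv_comp x (φ.mdiff_symm hx.1) hfst
  have h3 : mfderiv 𝓘(ℝ, Jet m) 𝓘(ℝ, Base m) (jetProj B ∘ φ.jetChart.symm) x =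
      mfderiv 𝓘(ℝ, Jet m) 𝓘(ℝ, Base m) (φ.coord.symm ∘ Prod.fst) x := by
    refine Filter.EventuallyEq.mfderiv_eq ?_
    filter_upwards [φ.jetChart.open_target.mem_nhds hx] with y hy
    exact congrArg TotalSpace.proj (φ.jetChart_symm_val hy.1)
  rw [mfderiv_eq_fderiv, fderiv_fst] at h2
  have h1' : (mfderiv 𝓘(ℝ, Jet m) 𝓘(ℝ, Base m) (jetProj B ∘ φ.jetChart.symm) x a : Base m) =
    (dProj (φ.jetChart.symm x)
      (mfderiv 𝓘(ℝ, Jet m) 𝓘(ℝ, Jet m) φ.jetChart.symm x a) : Base m) := DFunLike.congr_fun h1 a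
  have h2' : (mfderiv 𝓘(ℝ, Jet m) 𝓘(ℝ, Base m) (φ.coord.symm ∘ Prod.fst) x a : Base m) =
    (φ.dsymm x.1 a.1 : Base m) := DFunLike.congr_fun h2 a
  have h3' : (mfderiv 𝓘(ℝ, Jet m) 𝓘(ℝ, Base m) (jetProj B ∘ φ.jetChart.symm) x a : Base m) =
    (mfderiv 𝓘(ℝ, Jet m) 𝓘(ℝ, Base m) (φ.coord.symm ∘ Prod.fst) x a : Base m) :=
    DFunLike.congr_fun h3 a
  exact h1'.symm.trans (h3'.trans h2')

lemma DynamicConnection.contMDiff_lift_vel (γ : DynamicConnection B) :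
    ContMDiff (𝓘(ℝ, Jet m).tangent) (𝓘(ℝ, Jet m).tangent) ∞
      (fun w : TangentBundle 𝓘(ℝ, Jet m) (J1 B) =>
        (⟨w.1, dtJ w.1 w.2 • γ.lift w.1 (vel w.1)⟩ : TangentBundle 𝓘(ℝ, Jet m) (J1 B))) := by
  intro w₀
  obtain ⟨φ, hq⟩ := exists_bundleChart B (jetProj B w₀.1)
  let N : Set (TangentBundle 𝓘(ℝ, Jet m) (J1 B)) := TotalSpace.proj ⁻¹' φ.jetChart.source
  have hN : IsOpen N := φ.jetChart.open_source.preimage (FiberBundle.continuous_proj _ _)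
  have hwN : w₀ ∈ N := hq
  refine ContMDiffOn.contMDiffAt (s := N) ?_ (hN.mem_nhds hwN)
  have hdt : ContMDiff 𝓘(ℝ, Jet m).tangent 𝓘(ℝ, ℝ) ∞
      (fun w : TangentBundle 𝓘(ℝ, Jet m) (J1 B) => dtJ w.1 w.2) :=
    (contMDiff_snd_tangentBundle_modelSpace ℝ 𝓘(ℝ, ℝ)).comp
      ((contMDiff_jetTime B).contMDiff_tangentMap (by simp))
  have hx : ContMDiffOn 𝓘(ℝ, Jet m).tangent 𝓘(ℝ, Jet m) ∞
      (fun w : TangentBundle 𝓘(ℝ, Jet m) (J1 B) => φ.jetChart w.1) N :=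
    φ.contMDiffOn_jetChart.comp (Bundle.contMDiff_proj _).contMDiffOn (fun w hw => hw)
  have hv : ContMDiffOn 𝓘(ℝ, Jet m).tangent 𝓘(ℝ, Jet m) ∞
      (fun w : TangentBundle 𝓘(ℝ, Jet m) (J1 B) =>
        dtJ w.1 w.2 • (((1 : ℝ), (φ.jetChart w.1).2), (0 : Fib m))) N := by
    refine hdt.contMDiffOn.smul ?_
    have hc : ContDiff ℝ ∞ (fun x : Jet m => ((((1 : ℝ), x.2), (0 : Fib m)) : Jet m)) := by
      fun_prop
    exact hc.contMDiff.comp_contMDiffOn hx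
  have hsec : ContMDiffOn 𝓘(ℝ, Jet m).tangent 𝓘(ℝ, Jet m).tangent ∞
      (fun w : TangentBundle 𝓘(ℝ, Jet m) (J1 B) => (⟨φ.jetChart w.1,
        dtJ w.1 w.2 • (((1 : ℝ), (φ.jetChart w.1).2), (0 : Fib m))⟩ :
          TangentBundle 𝓘(ℝ, Jet m) (Jet m))) N := by
    intro w hw
    apply Bundle.contMDiffWithinAt_totalSpace.2
    refine ⟨hx w hw, ?_⟩
    convert! hv w hw using 1
    simp
  have hT := φ.contMDiffOn_jetChart_symm.contMDiffOn_tangentMapWithin (m := ∞) (by simp)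
    φ.jetChart.open_target.uniqueMDiffOn
  have hP := γ.smooth.comp_contMDiffOn
    (hT.comp hsec (fun w hw => φ.jetChart.map_source hw))
  refine hP.congr fun w hw => ?_
  have hz : φ.jetChart.symm (φ.jetChart w.1) = w.1 := φ.jetChart.left_inv hw
  have hxt : φ.jetChart w.1 ∈ φ.jetChart.target := φ.jetChart.map_source hw
  have hF := congrArg (fun z : J1 B =>
    (⟨z, dtJ w.1 w.2 • γ.lift z (vel z)⟩ : TangentBundle 𝓘(ℝ, Jet m) (J1 B))) hz
  refine hF.symm.trans ?_
  set c : ℝ := dtJ w.1 w.2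
  set x : Jet m := φ.jetChart w.1
  have hvel : (vel (φ.jetChart.symm x) : Base m) = (φ.dsymm x.1 (1, x.2) : Base m) :=
    congrArg (fun v : TangentBundle 𝓘(ℝ, Base m) Q => (v.2 : Base m)) (φ.jetChart_symm_val hxt.1)
  have hd := φ.dProj_symm hxt (c • (((1 : ℝ), x.2), (0 : Fib m)))
  have hd2 : dProj (φ.jetChart.symm x) (mfderivWithin 𝓘(ℝ, Jet m) 𝓘(ℝ, Jet m) φ.jetChart.symm
      φ.jetChart.target x (c • (((1 : ℝ), x.2), (0 : Fib m)))) =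
      c • vel (φ.jetChart.symm x) := by
    rw [mfderivWithin_of_isOpen φ.jetChart.open_target hxt]
    refine hd.trans ?_
    have h5 : (φ.dsymm x.1 (c • ((1 : ℝ), x.2)) : Base m) =
      c • (φ.dsymm x.1 (1, x.2) : Base m) := map_smul (φ.dsymm x.1) c ((1 : ℝ), x.2)
    exact h5.trans (congrArg (fun v : Base m => c • v) hvel.symm)
  have hd3 := congrArg (γ.lift (φ.jetChart.symm x)) hd2
  rw [map_smul] at hd3
  exact congrArg (TotalSpace.mk (F := Jet m) (E := TangentSpace 𝓘(ℝ, Jet m))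
    (φ.jetChart.symm x)) hd3.symm

/-- The holonomic connection `ξ_γ` defined by a dynamic connection `γ`: the vector `ξ_γ(z)` is the
`γ`-horizontal lift to `z` of the tangent vector `z` of `Q`. -/
def DynamicConnection.toHolonomic (γ : DynamicConnection B) : HolonomicConnection B :=
  ⟨{ lift := fun z => ContinuousLinearMap.toSpanSingleton ℝ (γ.lift z (vel z))
     mfderiv_lift := by
      intro z (v : ℝ)
      have h1 : dtJ z (v • γ.lift z (vel z)) = v := by
        rw [map_smul, dtJ_eq]
        have h2 : dProj z (γ.lift z (vel z)) = vel z := γ.mfderiv_lift z (vel z)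
        rw [h2, dtQ_vel]
        exact mul_one (v : ℝ)
      exact h1
     smooth := γ.contMDiff_lift_vel }, by
    intro z
    have h1 : dProj z ((1 : ℝ) • γ.lift z (vel z)) = vel z := by
      rw [one_smul]
      exact γ.mfderiv_lift z (vel z)
    exact h1⟩

end Connections

section VerticalEndomorphism

/-- The jet `z + s u`, where `u` is a vertical tangent vector to `Q → ℝ` at the point under `z`
(`J¹Q → Q` is an affine bundle modelled on the vertical tangent bundle `VQ`). -/
def affineLine (z : J1 B) (u : TangentSpace 𝓘(ℝ, Base m) (jetProj B z))
    (hu : dtQ B (jetProj B z) u = 0) (s : ℝ) : J1 B :=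
  ⟨⟨jetProj B z, vel z + s • u⟩, by
    change dtQ B (jetProj B z) (vel z + s • u) = 1
    rw [map_add, map_smul, hu, dtQ_vel, smul_zero, add_zero]⟩

/-- The vertical lift `α⁻¹`: the velocity at `s = 0` of the curve `s ↦ z + s u`. In coordinates it
sends `u = u^i ∂_i` to `u^i ∂_i^t`. -/
def verticalLift (z : J1 B) (u : TangentSpace 𝓘(ℝ, Base m) (jetProj B z))
    (hu : dtQ B (jetProj B z) u = 0) : TJ z :=
  (mfderiv 𝓘(ℝ, ℝ) 𝓘(ℝ, Jet m) (affineLine z u hu) 0 (1 : ℝ) : Jet m)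

/-- The vertical part `Tπ(w) - dt(w) z` of the projection to `TQ` of a tangent vector `w` to `J¹Q`
at `z`. -/
def contactPart (z : J1 B) (w : TJ z) : TangentSpace 𝓘(ℝ, Base m) (jetProj B z) :=
  dProj z w - dtQ B (jetProj B z) (dProj z w) • vel z

lemma dtQ_contactPart (z : J1 B) (w : TJ z) : dtQ B (jetProj B z) (contactPart z w) = 0 := by
  rw [contactPart, map_sub, map_smul, dtQ_vel, smul_eq_mul, mul_one, sub_self]

/-- The vertical endomorphism `v̂` of `TJ¹Q`:
`v̂(∂_t) = -q^i_t ∂_i^t`, `v̂(∂_i) = ∂_i^t`, `v̂(∂_i^t) = 0`. -/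
def vHat (z : J1 B) (w : TJ z) : TJ z :=
  verticalLift z (contactPart z w) (dtQ_contactPart z w)

/-- The fibre at `z` of the vertical tangent bundle `VJ¹Q` of `J¹Q → ℝ`. -/
def VJ (z : J1 B) : Submodule ℝ (TJ z) := LinearMap.ker (dtJ z : TJ z →ₗ[ℝ] ℝ)

/-- A linear endomorphism (over the identity) of the vertical tangent bundle `VJ¹Q`. -/
abbrev VerticalEndo (B : TimeBundle m M Q) := (z : J1 B) → VJ z →ₗ[ℝ] VJ z

/-- `I` is the endomorphism `I_ξ` of `VJ¹Q`, i.e. `I(u) = [ξ, v̂(u)] - v̂([ξ, u])` for all (local)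
vertical vector fields `u` on `J¹Q → ℝ`. -/
def IsBracketEndo (ξ : HolonomicConnection B) (I : VerticalEndo B) : Prop :=
  ∀ (W : Set (J1 B)) (u : (z : J1 B) → TJ z), IsOpen W →
    ContMDiffOn 𝓘(ℝ, Jet m) 𝓘(ℝ, Jet m).tangent ∞
      (fun z => (⟨z, u z⟩ : TangentBundle 𝓘(ℝ, Jet m) (J1 B))) W →
    ∀ hu : ∀ z ∈ W, u z ∈ VJ z, ∀ (z : J1 B) (hz : z ∈ W),
      (I z ⟨u z, hu z hz⟩ : TJ z) =
        VectorField.mlieBracket 𝓘(ℝ, Jet m) ξ.field (fun y => vHat y (u y)) z -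
          vHat z (VectorField.mlieBracket 𝓘(ℝ, Jet m) ξ.field u z)

/-- The projection `ξ̂ : TJ¹Q → VJ¹Q`, `w ↦ w - dt(w) ξ`, defined by a holonomic connection. -/
def HolonomicConnection.vertProj (ξ : HolonomicConnection B) (z : J1 B) (w : TJ z) : VJ z :=
  ⟨w - dtJ z w • ξ.field z, by
    change dtJ z (w - dtJ z w • ξ.field z) = 0
    rw [map_sub, map_smul, ξ.dtJ_field, smul_eq_mul, mul_one, sub_self]⟩

/-- The projection `w ↦ w - γ(Tπ(w))` of `TJ¹Q` onto the vertical tangent bundle `V_Q J¹Q` of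
`J¹Q → Q`, defined by a dynamic connection. -/
def DynamicConnection.vertProj (γ : DynamicConnection B) (z : J1 B) (w : TJ z) : TJ z :=
  w - γ.lift z (dProj z w)

end VerticalEndomorphism

section Components

/-- The differential of the coordinates `(t, q^i, q^i_t)`: the coordinate components of a tangent
vector to `J¹Q`. -/
def BundleChart.dJet (φ : BundleChart B) (z : J1 B) : TJ z →L[ℝ] Jet m :=
  mfderiv 𝓘(ℝ, Jet m) 𝓘(ℝ, Jet m) φ.jetChart z

/-- The coordinate `q^i_t`. -/
def qt (φ : BundleChart B) (i : Fin m) (z : J1 B) : ℝ := (φ.jetChart z).2 i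

/-- The partial derivative `∂_i^t f = ∂f/∂q^i_t` of a function on `J¹Q`. -/
def dqt (φ : BundleChart B) (i : Fin m) (f : J1 B → ℝ) (z : J1 B) : ℝ :=
  fderiv ℝ (f ∘ φ.jetChart.symm) (φ.jetChart z) ((0 : Base m), EuclideanSpace.single i (1 : ℝ))

/-- The component `ξ^i` of a holonomic connection `ξ = ∂_t + q^i_t ∂_i + ξ^i ∂_i^t`. -/
def xiComp (φ : BundleChart B) (ξ : HolonomicConnection B) (i : Fin m) (z : J1 B) : ℝ :=
  (φ.dJet z (ξ.field z)).2 i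

/-- The coordinate vector with components `a` at a point `q` of `Q`. -/
def coordVec (φ : BundleChart B) (q : Q) (a : Base m) : TangentSpace 𝓘(ℝ, Base m) q :=
  (φ.dsymm (φ.coord q) a : Base m)

/-- The component `γ^i_0` of `γ = dt ⊗ (∂_t + γ^i_0 ∂_i^t) + dq^j ⊗ (∂_j + γ^i_j ∂_i^t)`: the
`∂_i^t` component of the lift of `∂_t`. -/
def gammaTime (φ : BundleChart B) (γ : DynamicConnection B) (i : Fin m) (z : J1 B) : ℝ :=
  (φ.dJet z (γ.lift z (coordVec φ (jetProj B z) ((1 : ℝ), (0 : Fib m))))).2 i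

/-- The component `γ^i_j` of `γ = dt ⊗ (∂_t + γ^i_0 ∂_i^t) + dq^j ⊗ (∂_j + γ^i_j ∂_i^t)`: the
`∂_i^t` component of the lift of `∂_j`. -/
def gammaSpace (φ : BundleChart B) (γ : DynamicConnection B) (i j : Fin m) (z : J1 B) : ℝ :=
  (φ.dJet z (γ.lift z (coordVec φ (jetProj B z)
    ((0 : ℝ), EuclideanSpace.single j (1 : ℝ))))).2 i

/-- A dynamic connection is symmetric if `γ^k_i = ∂_i^t γ^k_0 + q^j_t ∂_i^t γ^k_j` in all
bundle coordinates. -/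
def DynamicConnection.IsSymmetric (γ : DynamicConnection B) : Prop :=
  ∀ (φ : BundleChart B) (z : J1 B), jetProj B z ∈ φ.coord.source → ∀ i k : Fin m,
    gammaSpace φ γ k i z =
      dqt φ i (gammaTime φ γ k) z + ∑ j, qt φ j z * dqt φ i (gammaSpace φ γ k j) z

end Components

end TimeMech

end

/-
In bundle coordinates `I_ξ(a^i ∂_i + b^i ∂_i^t) = -a^i ∂_i + (b^i - a^j ∂_j^t ξ^i) ∂_i^t`. The
bracket formula is intrinsic, so these local expressions agree on overlaps, and with them the
projections `½ (I_ξ + Id) ∘ ξ̂`, whose kernels are the horizontal subspaces of `γ_ξ`: no transition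
function has to be computed. By the Leibniz rule, `∂_i^t ξ_γ^k = ∂_i^t (γ^k_0 + q^j_t γ^k_j)`
exceeds the right-hand side of the symmetry condition by `γ^k_i`, so `γ` is symmetric if and only if
`γ^k_i = ½ ∂_i^t ξ_γ^k`. Since `ξ_{γ_ξ} = ξ`, the connection `γ_ξ` satisfies this condition, and
since `γ` is determined by `ξ_γ` and the `γ^k_i`, the condition amounts to `γ = γ_{ξ_γ}`.
-/

noncomputable section

namespace TimeMech

section ManifoldCharts

open VectorField

variable {𝕜 : Type*} [NontriviallyNormedField 𝕜]
  {E : Type*} [NormedAddCommGroup E] [NormedSpace 𝕜 E] {H : Type*} [TopologicalSpace H]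
  {I : ModelWithCorners 𝕜 E H} {X : Type*} [TopologicalSpace X] [ChartedSpace H X]
  {F : Type*} [NormedAddCommGroup F] [NormedSpace 𝕜 F]
  {e : OpenPartialHomeomorph X F}

lemma isInvertible_mfderiv_symm (he : e.MDifferentiable I 𝓘(𝕜, F)) {x : F} (hx : x ∈ e.target) :
    (mfderiv 𝓘(𝕜, F) I e.symm x).IsInvertible :=
  ⟨he.symm.mfderiv hx, rfl⟩

lemma mpullback_symm_apply (he : e.MDifferentiable I 𝓘(𝕜, F)) (V : (p : X) → TangentSpace I p)
    {p : X} (hp : p ∈ e.source) :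
    mpullback 𝓘(𝕜, F) I e.symm V (e p) = mfderiv I 𝓘(𝕜, F) e p (V p) := by
  have h : mpullback 𝓘(𝕜, F) I e.symm V (e p) =
      mfderiv I 𝓘(𝕜, F) e (e.symm (e p)) (V (e.symm (e p))) :=
    DFunLike.congr_fun (ContinuousLinearMap.inverse_equiv (he.symm.mfderiv (e.map_source hp))) _
  rw [h, e.left_inv hp]

lemma mfderiv_chart_velocity (he : e.MDifferentiable I 𝓘(𝕜, F)) {c : 𝕜 → X} {s : 𝕜}
    (hc : ∀ r, c r ∈ e.source) (hec : DifferentiableAt 𝕜 (e ∘ c) s) {p : X} (hp : c s = p) :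
    (mfderiv I 𝓘(𝕜, F) e p (mfderiv 𝓘(𝕜, 𝕜) I c s (1 : 𝕜) : E) : F) = deriv (e ∘ c) s := by
  subst hp
  have h_symm : c = e.symm ∘ e ∘ c := funext fun r => (e.left_inv (hc r)).symm
  have h_diff : MDifferentiableAt 𝓘(𝕜, 𝕜) I c s := by
    rw [h_symm]
    exact (he.mdifferentiableAt_symm (e.map_source (hc s))).comp s hec.mdifferentiableAt
  have h_chain := mfderiv_comp s (he.mdifferentiableAt (hc s)) h_diff
  rw [mfderiv_eq_fderiv] at h_chain
  exact (DFunLike.congr_fun h_chain (1 : 𝕜)).symm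

section Smooth

variable {n k : ℕ∞ω}

lemma mdifferentiable_of_contMDiffOn (he : ContMDiffOn I 𝓘(𝕜, F) n e e.source)
    (he' : ContMDiffOn 𝓘(𝕜, F) I n e.symm e.target) (hn : n ≠ 0) :
    e.MDifferentiable I 𝓘(𝕜, F) :=
  ⟨he.mdifferentiableOn hn, he'.mdifferentiableOn hn⟩

variable [IsManifold I 1 X]
  {E' : Type*} [NormedAddCommGroup E'] [NormedSpace 𝕜 E'] {H' : Type*} [TopologicalSpace H']
  {J : ModelWithCorners 𝕜 E' H'} {N : Type*} [TopologicalSpace N] [ChartedSpace H' N]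

lemma contMDiffOn_mfderiv_chart (he : ContMDiffOn I 𝓘(𝕜, F) n e e.source) (hkn : k + 1 ≤ n) :
    ContMDiffOn I.tangent 𝓘(𝕜, F) k
      (fun w : TangentBundle I X => (mfderiv I 𝓘(𝕜, F) e w.1 w.2 : F))
      (TotalSpace.proj ⁻¹' e.source) := by
  refine ((contMDiff_snd_tangentBundle_modelSpace F 𝓘(𝕜, F)).comp_contMDiffOn
    (he.contMDiffOn_tangentMapWithin hkn e.open_source.uniqueMDiffOn)).congr fun w hw => ?_
  rw [← mfderivWithin_of_isOpen e.open_source hw]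
  rfl

lemma contMDiffOn_mfderiv_chart_symm (he : ContMDiffOn 𝓘(𝕜, F) I n e.symm e.target)
    (hkn : k + 1 ≤ n) :
    ContMDiffOn 𝓘(𝕜, F × F) I.tangent k
      (fun x : F × F => (⟨e.symm x.1, mfderiv 𝓘(𝕜, F) I e.symm x.1 x.2⟩ : TangentBundle I X))
      (Prod.fst ⁻¹' e.target) := by
  have h_section : ContMDiff 𝓘(𝕜, F × F) 𝓘(𝕜, F).tangent k
      (fun x : F × F => (⟨x.1, x.2⟩ : TangentBundle 𝓘(𝕜, F) F)) := fun x =>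
    contMDiffAt_totalSpace.2 ⟨contDiff_fst.contMDiff x, by
      convert! contDiff_snd.contMDiff.contMDiffAt (x := x) using 1; simp⟩
  refine ((he.contMDiffOn_tangentMapWithin hkn e.open_target.uniqueMDiffOn).comp
    h_section.contMDiffOn fun x hx => hx).congr fun x hx => ?_
  rw [← mfderivWithin_of_isOpen e.open_target hx]
  rfl

lemma contMDiffAt_tangentBundle_iff (he : ContMDiffOn I 𝓘(𝕜, F) n e e.source)
    (he' : ContMDiffOn 𝓘(𝕜, F) I n e.symm e.target) (hkn : k + 1 ≤ n)
    {f : N → TangentBundle I X} {y : N} (hy : (f y).1 ∈ e.source) :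
    ContMDiffAt J I.tangent k f y ↔ ContMDiffAt J I k (fun y => (f y).1) y ∧
      ContMDiffAt J 𝓘(𝕜, F) k (fun y => (mfderiv I 𝓘(𝕜, F) e (f y).1 (f y).2 : F)) y := by
  have h_open : IsOpen (TotalSpace.proj ⁻¹' e.source : Set (TangentBundle I X)) :=
    e.open_source.preimage (FiberBundle.continuous_proj E (TangentSpace I))
  refine ⟨fun hf => ⟨(Bundle.contMDiff_proj (TangentSpace I)).contMDiffAt.comp y hf,
    ((contMDiffOn_mfderiv_chart he hkn).contMDiffAt (h_open.mem_nhds hy)).comp y hf⟩,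
    fun ⟨hb, hv⟩ => ?_⟩
  have h_diff := mdifferentiable_of_contMDiffOn he he' (by rintro rfl; simp at hkn)
  have h_chart : ContMDiffAt J 𝓘(𝕜, F) k (fun y => e (f y).1) y :=
    (he.contMDiffAt (e.open_source.mem_nhds hy)).of_le (le_self_add.trans hkn) |>.comp y hb
  refine (((contMDiffOn_mfderiv_chart_symm he' hkn).contMDiffAt
    ((e.open_target.preimage continuous_fst).mem_nhds (e.map_source hy))).comp y
    (h_chart.prodMk_space hv)).congr_of_eventuallyEq ?_
  filter_upwards [hb.continuousAt.preimage_mem_nhds (e.open_source.mem_nhds hy)] with p hp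
  refine TotalSpace.ext (e.left_inv hp).symm (heq_of_eq ?_)
  exact (DFunLike.congr_fun (h_diff.symm_comp_deriv hp) (f p).2).symm

end Smooth

section LieBracket

variable [CompleteSpace F] {n : ℕ∞ω} {V W : (p : X) → TangentSpace I p} {p : X}

lemma contDiffAt_mpullback_symm [IsManifold I 1 X] (he : e.MDifferentiable I 𝓘(𝕜, F))
    (he' : ContMDiffOn 𝓘(𝕜, F) I n e.symm e.target) {k : ℕ∞ω} (hkn : k + 1 ≤ n)
    (hp : p ∈ e.source)
    (hV : ContMDiffAt I I.tangent k (fun p => (⟨p, V p⟩ : TangentBundle I X)) p) :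
    ContDiffAt 𝕜 k (mpullback 𝓘(𝕜, F) I e.symm V) (e p) := by
  rw [← contMDiffAt_vectorSpace_iff_contDiffAt]
  exact ContMDiffAt.mpullback_vectorField_preimage (by rwa [e.left_inv hp])
    (he'.contMDiffAt (e.open_target.mem_nhds (e.map_source hp)))
    (isInvertible_mfderiv_symm he (e.map_source hp)) hkn

lemma mfderiv_chart_mlieBracket [IsRCLikeNormedField 𝕜] [IsManifold I (minSmoothness 𝕜 2) X]
    (he : e.MDifferentiable I 𝓘(𝕜, F))
    (he' : ContMDiffOn 𝓘(𝕜, F) I n e.symm e.target) (hn : minSmoothness 𝕜 2 ≤ n)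
    (hp : p ∈ e.source)
    (hV : MDifferentiableAt I I.tangent (fun p => (⟨p, V p⟩ : TangentBundle I X)) p)
    (hW : MDifferentiableAt I I.tangent (fun p => (⟨p, W p⟩ : TangentBundle I X)) p) :
    (mfderiv I 𝓘(𝕜, F) e p (mlieBracket I V W p) : F) =
      lieBracket 𝕜 (mpullback 𝓘(𝕜, F) I e.symm V) (mpullback 𝓘(𝕜, F) I e.symm W) (e p) := by
  rw [← mpullback_symm_apply he _ hp, mpullback_mlieBracket (n := n) (by rwa [e.left_inv hp])
    (by rwa [e.left_inv hp]) (he'.contMDiffAt (e.open_target.mem_nhds (e.map_source hp))) hn,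
    ← mlieBracketWithin_univ, mlieBracketWithin_eq_lieBracketWithin]
  exact congrFun lieBracketWithin_univ (e p)

end LieBracket

end ManifoldCharts

section FlatModel

open VectorField

variable {F G : Type*} [NormedAddCommGroup F] [NormedSpace ℝ F]
  [NormedAddCommGroup G] [NormedSpace ℝ G]

/-- The coordinate expression of `v̂` at the point with coordinates `x = (t, q, q_t)`. -/
def modelVHat (x a : (ℝ × F) × F) : (ℝ × F) × F := (0, a.1.2 - a.1.1 • x.2)

/-- The derivative `∂^t f` along the fibres of the affine bundle `(t, q, q_t) ↦ (t, q)`. -/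
def fibreDeriv (f : (ℝ × F) × F → G) (x : (ℝ × F) × F) : F →L[ℝ] G :=
  fderiv ℝ f x ∘L ContinuousLinearMap.inr ℝ (ℝ × F) F

/-- The coordinate expression of `I_ξ`, where `D` stands for `∂^t ξ`. -/
def modelBracketEndo (D : F →L[ℝ] F) : (ℝ × F) × F →ₗ[ℝ] (ℝ × F) × F where
  toFun a := ((0, -a.1.2), a.2 - D a.1.2)
  map_add' a b := by
    ext <;> simp only [Prod.fst_add, Prod.snd_add, map_add] <;> abel
  map_smul' c a := by
    ext <;> simp [smul_sub]

/-- The coordinate expression of the horizontal lift of `γ_ξ`, where `v`, `f` and `D` stand for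
`q_t`, `ξ` and `∂^t ξ`. -/
def modelLift (v f : F) (D : F →L[ℝ] F) : ℝ × F →L[ℝ] (ℝ × F) × F :=
  (ContinuousLinearMap.id ℝ (ℝ × F)).prod ((ContinuousLinearMap.fst ℝ ℝ F).smulRight f +
    (1 / 2 : ℝ) • D ∘L
      (ContinuousLinearMap.snd ℝ ℝ F - (ContinuousLinearMap.fst ℝ ℝ F).smulRight v))

lemma modelBracketEndo_apply (D : F →L[ℝ] F) (a : (ℝ × F) × F) :
    modelBracketEndo D a = ((0, -a.1.2), a.2 - D a.1.2) := rfl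

lemma modelLift_apply (v f : F) (D : F →L[ℝ] F) (a : ℝ × F) :
    modelLift v f D a = (a, a.1 • f + (1 / 2 : ℝ) • D (a.2 - a.1 • v)) := rfl

lemma contDiff_modelLift {n : ℕ∞ω} : ContDiff ℝ n fun p : F × F × (F →L[ℝ] F) × (ℝ × F) =>
    modelLift p.1 p.2.1 p.2.2.1 p.2.2.2 := by
  simp only [modelLift_apply]
  fun_prop

lemma contDiff_modelVHat {n : ℕ∞ω} :
    ContDiff ℝ n fun p : ((ℝ × F) × F) × ((ℝ × F) × F) => modelVHat p.1 p.2 := by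
  unfold modelVHat
  fun_prop

/-- The projection `½ (I_ξ + Id) ∘ ξ̂` is the vertical projection of `γ_ξ`. -/
lemma sub_half_smul_modelBracketEndo (v f : F) (D : F →L[ℝ] F) (a : (ℝ × F) × F) :
    a - (1 / 2 : ℝ) • (modelBracketEndo D (a - a.1.1 • ((1, v), f)) + (a - a.1.1 • ((1, v), f))) =
      modelLift v f D a.1 := by
  rw [modelBracketEndo_apply, modelLift_apply]
  refine Prod.ext (Prod.ext (by simp) ?_) ?_
  · simp only [Prod.snd_sub, Prod.fst_sub, Prod.snd_add, Prod.fst_add, Prod.smul_fst, Prod.smul_snd]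
    module
  · simp only [Prod.snd_sub, Prod.fst_sub, Prod.snd_add, Prod.smul_fst, Prod.smul_snd]
    module

lemma lieBracket_modelVHat_sub {X U : (ℝ × F) × F → (ℝ × F) × F} {x : (ℝ × F) × F}
    (hX : DifferentiableAt ℝ X x) (hU : DifferentiableAt ℝ U x)
    (hX₁ : ∀ᶠ y in 𝓝 x, (X y).1 = (1, y.2)) (hU₁ : ∀ᶠ y in 𝓝 x, (U y).1.1 = 0) :
    lieBracket ℝ X (fun y => modelVHat y (U y)) x - modelVHat x (lieBracket ℝ X U x) =
      modelBracketEndo (fibreDeriv (fun y => (X y).2) x) (U x) := by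
  have hX' : X =ᶠ[𝓝 x] fun y => ((1, y.2), (X y).2) := hX₁.mono fun y hy => Prod.ext hy rfl
  have hU' : U =ᶠ[𝓝 x] fun y => ((0, (U y).1.2), (U y).2) :=
    hU₁.mono fun y hy => Prod.ext (Prod.ext hy rfl) rfl
  have hV : (fun y => modelVHat y (U y)) =ᶠ[𝓝 x] fun y => (0, (U y).1.2) :=
    hU₁.mono fun y hy => by simp [modelVHat, hy]
  have hDX := (((hasFDerivAt_const (1 : ℝ) x).prodMk hasFDerivAt_snd).prodMk
    hX.hasFDerivAt.snd).congr_of_eventuallyEq hX'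
  have hDU := (((hasFDerivAt_const (0 : ℝ) x).prodMk hU.hasFDerivAt.fst.snd).prodMk
    hU.hasFDerivAt.snd).congr_of_eventuallyEq hU'
  have hDV := ((hasFDerivAt_const (0 : ℝ × F) x).prodMk
    hU.hasFDerivAt.fst.snd).congr_of_eventuallyEq hV
  have hDU₁ (a) : (fderiv ℝ U x a).1.1 = 0 := by rw [hDU.fderiv]; rfl
  rw [lieBracket, lieBracket, hDV.fderiv, hDX.fderiv, modelBracketEndo_apply,
    fibreDeriv, hX.hasFDerivAt.snd.fderiv]
  ext <;> simp [modelVHat, hDU₁, hU₁.self_of_nhds]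

end FlatModel

lemma apply_eq_sum_single {ι G H : Type*} [Fintype ι] [DecidableEq ι] [AddCommGroup G]
    [Module ℝ G] [FunLike H (EuclideanSpace ℝ ι) G] [LinearMapClass H ℝ (EuclideanSpace ℝ ι) G]
    (L : H) (y : EuclideanSpace ℝ ι) : L y = ∑ j, y j • L (EuclideanSpace.single j 1) := by
  conv_lhs => rw [← (EuclideanSpace.basisFun ι ℝ).sum_repr y]
  simp

variable {m : ℕ}
  {M : Type*} [TopologicalSpace M] [ChartedSpace (Fib m) M] [IsManifold 𝓘(ℝ, Fib m) ∞ M]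
  {Q : Type*} [TopologicalSpace Q] [ChartedSpace (Base m) Q] [IsManifold 𝓘(ℝ, Base m) ∞ Q]
  {B : TimeBundle m M Q}

section JetCoordinates

variable (φ : BundleChart B)

lemma BundleChart.d_injective {q : Q} (hq : q ∈ φ.coord.source) : Function.Injective (φ.d q) :=
  Function.LeftInverse.injective (g := coordVec φ q) (φ.dsymm_d hq)

lemma BundleChart.d_coordVec {q : Q} (hq : q ∈ φ.coord.source) (a : Base m) :
    φ.d q (coordVec φ q a) = a := by
  have h := φ.d_dsymm (φ.coord.map_source hq) a
  rwa [φ.coord.left_inv hq] at h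

lemma BundleChart.mdifferentiable_jetChart : φ.jetChart.MDifferentiable 𝓘(ℝ, Jet m) 𝓘(ℝ, Jet m) :=
  mdifferentiable_of_mem_atlas φ.jetChart_mem

/-- The tangent vector to `J¹Q` with given components in a jet chart (junk outside the chart). -/
def BundleChart.jetVec (z : J1 B) : Jet m →L[ℝ] TJ z := (φ.dJet z).inverse

section Pointwise

variable {z : J1 B} (hz : jetProj B z ∈ φ.coord.source)
include hz

lemma BundleChart.isInvertible_dJet : (φ.dJet z).IsInvertible :=
  ⟨φ.mdifferentiable_jetChart.mfderiv hz, rfl⟩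

lemma BundleChart.dJet_injective : Function.Injective (φ.dJet z) :=
  (φ.isInvertible_dJet hz).injective

lemma BundleChart.dJet_jetVec (a : Jet m) : φ.dJet z (φ.jetVec z a) = a :=
  DFunLike.congr_fun (φ.isInvertible_dJet hz).self_comp_inverse a

lemma BundleChart.d_dProj (w : TJ z) : φ.d (jetProj B z) (dProj z w) = (φ.dJet z w).1 := by
  have h_proj := mfderiv_comp z (φ.mdiff hz)
    ((contMDiff_jetProj B).mdifferentiableAt (x := z) (by simp))
  have h_fst : MDifferentiableAt 𝓘(ℝ, Jet m) 𝓘(ℝ, Base m) Prod.fst (φ.jetChart z) :=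
    differentiableAt_fst.mdifferentiableAt
  have h_chart := mfderiv_comp z h_fst (φ.mdifferentiable_jetChart.mdifferentiableAt hz)
  rw [mfderiv_eq_fderiv, fderiv_fst] at h_chart
  exact DFunLike.congr_fun (h_proj.symm.trans h_chart) w

lemma BundleChart.dJet_fst_fst (w : TJ z) : (φ.dJet z w).1.1 = dtJ z w := by
  rw [← φ.d_dProj hz, φ.d_fst hz, dtJ_eq]

lemma BundleChart.mem_VJ_iff (w : TJ z) : w ∈ VJ z ↔ (φ.dJet z w).1.1 = 0 := by
  rw [φ.dJet_fst_fst hz]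
  rfl

lemma BundleChart.d_vel : φ.d (jetProj B z) (vel z) = (1, (φ.jetChart z).2) :=
  Prod.ext ((φ.d_fst hz (vel z)).trans (dtQ_vel z)) rfl

lemma BundleChart.dJet_verticalLift (u : TangentSpace 𝓘(ℝ, Base m) (jetProj B z))
    (hu : dtQ B (jetProj B z) u = 0) :
    φ.dJet z (verticalLift z u hu) = (0, (φ.d (jetProj B z) u).2) := by
  set a : Jet m := (0, (φ.d (jetProj B z) u).2)
  have h_line : φ.jetChart ∘ affineLine z u hu = fun s : ℝ => φ.jetChart z + s • a := by
    funext s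
    refine Prod.ext ?_ ?_
    · change φ.coord (jetProj B z) = φ.coord (jetProj B z) + s • (0 : Base m)
      rw [smul_zero, add_zero]
    · change (φ.d (jetProj B z) (vel z + s • u)).2 = _
      rw [map_add, map_smul]
      rfl
  have h_deriv : HasDerivAt (φ.jetChart ∘ affineLine z u hu) a 0 := by
    rw [h_line]
    simpa using ((hasDerivAt_id (0 : ℝ)).smul_const a).const_add (φ.jetChart z)
  have h_zero : affineLine z u hu 0 = z :=
    J1.ext (congrArg (TotalSpace.mk (jetProj B z)) (by rw [zero_smul, add_zero]; rfl))
  exact (mfderiv_chart_velocity φ.mdifferentiable_jetChart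
    (c := affineLine z u hu) (fun _ => hz) h_deriv.differentiableAt h_zero).trans h_deriv.deriv

lemma BundleChart.dJet_vHat (w : TJ z) :
    φ.dJet z (vHat z w) = modelVHat (φ.jetChart z) (φ.dJet z w) := by
  rw [vHat, φ.dJet_verticalLift hz, contactPart, map_sub, map_smul, φ.d_vel hz, ← φ.d_fst hz,
    φ.d_dProj hz]
  rfl

lemma BundleChart.dProj_surjective : Function.Surjective (dProj z) := fun v =>
  ⟨φ.jetVec z (φ.d _ v, 0), φ.d_injective hz (by rw [φ.d_dProj hz, φ.dJet_jetVec hz])⟩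

end Pointwise

section Smoothness

variable {E H N : Type*} [NormedAddCommGroup E] [NormedSpace ℝ E] [TopologicalSpace H]
  {J : ModelWithCorners ℝ E H} [TopologicalSpace N] [ChartedSpace H N]

lemma BundleChart.contMDiffAt_jetChart {z : J1 B} (hz : jetProj B z ∈ φ.coord.source) :
    ContMDiffAt 𝓘(ℝ, Jet m) 𝓘(ℝ, Jet m) ∞ φ.jetChart z :=
  φ.contMDiffOn_jetChart.contMDiffAt (φ.jetChart.open_source.mem_nhds hz)

lemma BundleChart.eventually_mem_source {z : J1 B} (hz : jetProj B z ∈ φ.coord.source) :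
    ∀ᶠ y in 𝓝 z, jetProj B y ∈ φ.coord.source :=
  φ.jetChart.open_source.mem_nhds hz

lemma BundleChart.contMDiffAt_iff_dJet {f : N → TangentBundle 𝓘(ℝ, Jet m) (J1 B)} {y : N}
    (hy : jetProj B (f y).1 ∈ φ.coord.source) :
    ContMDiffAt J 𝓘(ℝ, Jet m).tangent ∞ f y ↔
      ContMDiffAt J 𝓘(ℝ, Jet m) ∞ (fun y => (f y).1) y ∧
        ContMDiffAt J 𝓘(ℝ, Jet m) ∞ (fun y => φ.dJet (f y).1 (f y).2) y :=
  contMDiffAt_tangentBundle_iff φ.contMDiffOn_jetChart φ.contMDiffOn_jetChart_symm (by simp) hy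

lemma BundleChart.contMDiffAt_jetVec {z : J1 B} (hz : jetProj B z ∈ φ.coord.source) (a : Jet m) :
    ContMDiffAt 𝓘(ℝ, Jet m) 𝓘(ℝ, Jet m).tangent ∞
      (fun y => (⟨y, φ.jetVec y a⟩ : TangentBundle 𝓘(ℝ, Jet m) (J1 B))) z :=
  (φ.contMDiffAt_iff_dJet hz).2 ⟨contMDiffAt_id, contMDiffAt_const.congr_of_eventuallyEq
    ((φ.eventually_mem_source hz).mono fun _ hy => φ.dJet_jetVec hy a)⟩

lemma contMDiffAt_vHat {u : (z : J1 B) → TJ z} {z : J1 B}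
    (hu : ContMDiffAt 𝓘(ℝ, Jet m) 𝓘(ℝ, Jet m).tangent ∞
      (fun y => (⟨y, u y⟩ : TangentBundle 𝓘(ℝ, Jet m) (J1 B))) z) :
    ContMDiffAt 𝓘(ℝ, Jet m) 𝓘(ℝ, Jet m).tangent ∞
      (fun y => (⟨y, vHat y (u y)⟩ : TangentBundle 𝓘(ℝ, Jet m) (J1 B))) z := by
  obtain ⟨φ, hz⟩ := exists_bundleChart B (jetProj B z)
  exact (φ.contMDiffAt_iff_dJet hz).2 ⟨contMDiffAt_id,
    (contDiff_modelVHat.contMDiff.contMDiffAt.comp z ((φ.contMDiffAt_jetChart hz).prodMk_space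
      ((φ.contMDiffAt_iff_dJet hz).1 hu).2)).congr_of_eventuallyEq
    ((φ.eventually_mem_source hz).mono fun y hy => φ.dJet_vHat hy (u y))⟩

lemma HolonomicConnection.contMDiff_field (ξ : HolonomicConnection B) :
    ContMDiff 𝓘(ℝ, Jet m) 𝓘(ℝ, Jet m).tangent ∞
      (fun z => (⟨z, ξ.field z⟩ : TangentBundle 𝓘(ℝ, Jet m) (J1 B))) := by
  intro z
  obtain ⟨φ, hz⟩ := exists_bundleChart B (jetProj B z)
  refine (ξ.1.smooth.contMDiffAt.comp z
    (φ.contMDiffAt_jetVec hz ((1, 0), 0))).congr_of_eventuallyEq ?_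
  filter_upwards [φ.eventually_mem_source hz] with y hy
  have h_dt : dtJ y (φ.jetVec y ((1, 0), 0)) = 1 := by
    rw [← φ.dJet_fst_fst hy, φ.dJet_jetVec hy]
  exact congrArg (fun s : ℝ => TotalSpace.mk y (ξ.1.lift y s)) h_dt.symm

end Smoothness

end JetCoordinates

section BracketEndomorphism

open VectorField

variable (φ : BundleChart B) (ξ : HolonomicConnection B)

/-- The components of a vector field on `J¹Q` as functions of the coordinates `(t, q, q_t)`
(junk outside the range of the chart). -/
def BundleChart.fieldRep (V : (z : J1 B) → TJ z) : Jet m → Jet m :=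
  mpullback 𝓘(ℝ, Jet m) 𝓘(ℝ, Jet m) φ.jetChart.symm V

/-- The components `ξ^i` of a holonomic connection, as functions of the coordinates. -/
def BundleChart.xi (x : Jet m) : Fib m := (φ.fieldRep ξ.field x).2

section Pointwise

variable {z : J1 B} (hz : jetProj B z ∈ φ.coord.source)
include hz

lemma BundleChart.fieldRep_jetChart (V : (z : J1 B) → TJ z) :
    φ.fieldRep V (φ.jetChart z) = φ.dJet z (V z) :=
  mpullback_symm_apply φ.mdifferentiable_jetChart V hz

lemma BundleChart.contDiffAt_fieldRep {V : (z : J1 B) → TJ z}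
    (hV : ContMDiffAt 𝓘(ℝ, Jet m) 𝓘(ℝ, Jet m).tangent ∞
      (fun y => (⟨y, V y⟩ : TangentBundle 𝓘(ℝ, Jet m) (J1 B))) z) :
    ContDiffAt ℝ ∞ (φ.fieldRep V) (φ.jetChart z) :=
  contDiffAt_mpullback_symm φ.mdifferentiable_jetChart φ.contMDiffOn_jetChart_symm (by simp) hz hV

lemma BundleChart.contDiffAt_xi : ContDiffAt ℝ ∞ (φ.xi ξ) (φ.jetChart z) :=
  (φ.contDiffAt_fieldRep hz (ξ.contMDiff_field z)).snd

lemma BundleChart.dJet_field :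
    φ.dJet z (ξ.field z) = ((1, (φ.jetChart z).2), φ.xi ξ (φ.jetChart z)) := by
  refine Prod.ext ?_ (congrArg Prod.snd (φ.fieldRep_jetChart hz ξ.field)).symm
  rw [← φ.d_dProj hz, ← φ.d_vel hz]
  exact congrArg _ (ξ.2 z)

lemma BundleChart.dJet_mlieBracket {V W : (z : J1 B) → TJ z}
    (hV : ContMDiffAt 𝓘(ℝ, Jet m) 𝓘(ℝ, Jet m).tangent ∞
      (fun y => (⟨y, V y⟩ : TangentBundle 𝓘(ℝ, Jet m) (J1 B))) z)
    (hW : ContMDiffAt 𝓘(ℝ, Jet m) 𝓘(ℝ, Jet m).tangent ∞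
      (fun y => (⟨y, W y⟩ : TangentBundle 𝓘(ℝ, Jet m) (J1 B))) z) :
    φ.dJet z (mlieBracket 𝓘(ℝ, Jet m) V W z) =
      lieBracket ℝ (φ.fieldRep V) (φ.fieldRep W) (φ.jetChart z) := by
  have h_two : minSmoothness ℝ 2 ≤ ∞ := by
    rw [minSmoothness_of_isRCLikeNormedField]
    exact WithTop.coe_le_coe.2 le_top
  have : IsManifold 𝓘(ℝ, Jet m) (minSmoothness ℝ 2) (J1 B) := IsManifold.of_le h_two
  exact mfderiv_chart_mlieBracket φ.mdifferentiable_jetChart φ.contMDiffOn_jetChart_symm h_two hz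
    (hV.mdifferentiableAt (by simp)) (hW.mdifferentiableAt (by simp))

lemma BundleChart.dJet_bracket {u : (z : J1 B) → TJ z}
    (hu : ContMDiffAt 𝓘(ℝ, Jet m) 𝓘(ℝ, Jet m).tangent ∞
      (fun y => (⟨y, u y⟩ : TangentBundle 𝓘(ℝ, Jet m) (J1 B))) z)
    (hv : ∀ᶠ y in 𝓝 z, u y ∈ VJ y) :
    φ.dJet z (mlieBracket 𝓘(ℝ, Jet m) ξ.field (fun y => vHat y (u y)) z -
        vHat z (mlieBracket 𝓘(ℝ, Jet m) ξ.field u z)) =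
      modelBracketEndo (fibreDeriv (φ.xi ξ) (φ.jetChart z)) (φ.dJet z (u z)) := by
  have h_nhds := φ.eventually_mem_source hz
  have h_field : ∀ᶠ x in 𝓝 (φ.jetChart z), (φ.fieldRep ξ.field x).1 = (1, x.2) := by
    rw [φ.jetChart.eventually_nhds _ hz]
    filter_upwards [h_nhds] with y hy
    rw [φ.fieldRep_jetChart hy, φ.dJet_field ξ hy]
  have h_vertical : ∀ᶠ x in 𝓝 (φ.jetChart z), (φ.fieldRep u x).1.1 = 0 := by
    rw [φ.jetChart.eventually_nhds _ hz]
    filter_upwards [h_nhds, hv] with y hy hvy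
    rwa [φ.fieldRep_jetChart hy, ← φ.mem_VJ_iff hy]
  have h_vHat : φ.fieldRep (fun y => vHat y (u y)) =ᶠ[𝓝 (φ.jetChart z)]
      fun x => modelVHat x (φ.fieldRep u x) := by
    refine (φ.jetChart.eventually_nhds _ hz).2 ?_
    filter_upwards [h_nhds] with y hy
    rw [φ.fieldRep_jetChart hy, φ.fieldRep_jetChart hy, φ.dJet_vHat hy]
  have hξ := ξ.contMDiff_field z
  rw [map_sub, φ.dJet_vHat hz, φ.dJet_mlieBracket hz hξ (contMDiffAt_vHat hu),
    φ.dJet_mlieBracket hz hξ hu, EventuallyEq.rfl.lieBracket_vectorField_eq h_vHat,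
    lieBracket_modelVHat_sub
      ((φ.contDiffAt_fieldRep hz hξ).differentiableAt (by simp))
      ((φ.contDiffAt_fieldRep hz hu).differentiableAt (by simp))
      h_field h_vertical, φ.fieldRep_jetChart hz]
  rfl

end Pointwise

/-- A bundle chart around the base point of `z`, used to define objects on `J¹Q` by their
coordinate expressions. -/
def bundleChartAt (z : J1 B) : BundleChart B := (exists_bundleChart B (jetProj B z)).choose

lemma mem_bundleChartAt_source (z : J1 B) : jetProj B z ∈ (bundleChartAt z).coord.source :=
  (exists_bundleChart B (jetProj B z)).choose_spec

/-- The endomorphism `I_ξ` of `VJ¹Q`. -/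
def HolonomicConnection.bracketEndo : VerticalEndo B := fun z =>
  let φ := bundleChartAt z
  (φ.jetVec z ∘ₗ modelBracketEndo (fibreDeriv (φ.xi ξ) (φ.jetChart z)) ∘ₗ φ.dJet z ∘ₗ
    (VJ z).subtype).codRestrict (VJ z) fun v => by
    have hz : jetProj B z ∈ φ.coord.source := mem_bundleChartAt_source z
    refine (φ.mem_VJ_iff hz _).2 ?_
    exact congrArg (fun a : Jet m => a.1.1) (φ.dJet_jetVec hz _)

lemma HolonomicConnection.isBracketEndo_bracketEndo : IsBracketEndo ξ ξ.bracketEndo := by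
  intro W u hW hu hv z hzW
  have hz := mem_bundleChartAt_source z
  have hW_nhds := hW.mem_nhds hzW
  apply (bundleChartAt z).dJet_injective hz
  rw [(bundleChartAt z).dJet_bracket ξ hz (hu.contMDiffAt hW_nhds) (eventually_of_mem hW_nhds hv)]
  exact (bundleChartAt z).dJet_jetVec hz _

variable {ξ}

lemma IsBracketEndo.dJet_apply {I : VerticalEndo B} (hI : IsBracketEndo ξ I) {z : J1 B}
    (hz : jetProj B z ∈ φ.coord.source) (v : VJ z) :
    φ.dJet z (I z v) =
      modelBracketEndo (fibreDeriv (φ.xi ξ) (φ.jetChart z)) (φ.dJet z v) := by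
  set a : Jet m := φ.dJet z v
  have h_smooth {y : J1 B} (hy : jetProj B y ∈ φ.coord.source) := φ.contMDiffAt_jetVec hy a
  have h_vertical : ∀ y ∈ φ.jetChart.source, φ.jetVec y a ∈ VJ y := fun y hy => by
    rw [φ.mem_VJ_iff hy, φ.dJet_jetVec hy]
    exact (φ.mem_VJ_iff hz _).1 v.2
  have h_value : φ.jetVec z a = v := φ.dJet_injective hz (φ.dJet_jetVec hz a)
  have h_bracket := hI φ.jetChart.source (fun y => φ.jetVec y a) φ.jetChart.open_source
    (fun y hy => (h_smooth hy).contMDiffWithinAt) h_vertical z hz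
  rw [show v = ⟨φ.jetVec z a, h_vertical z hz⟩ from Subtype.ext h_value.symm, h_bracket,
    φ.dJet_bracket ξ hz (h_smooth hz)
      (eventually_of_mem (φ.jetChart.open_source.mem_nhds hz) h_vertical), φ.dJet_jetVec hz]

lemma IsBracketEndo.unique {I I' : VerticalEndo B} (hI : IsBracketEndo ξ I)
    (hI' : IsBracketEndo ξ I') : I = I' := by
  funext z
  obtain ⟨φ, hz⟩ := exists_bundleChart B (jetProj B z)
  exact LinearMap.ext fun v => Subtype.ext <| φ.dJet_injective hz <|
    (hI.dJet_apply φ hz v).trans (hI'.dJet_apply φ hz v).symm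

end BracketEndomorphism

section InducedConnection

variable (φ : BundleChart B) (ξ : HolonomicConnection B)

/-- The horizontal lift of `γ_ξ`, defined by its expression in the chart `φ`. -/
def BundleChart.inducedLift (z : J1 B) :
    TangentSpace 𝓘(ℝ, Base m) (jetProj B z) →L[ℝ] TJ z :=
  φ.jetVec z ∘L modelLift (φ.jetChart z).2 (φ.xi ξ (φ.jetChart z))
    (fibreDeriv (φ.xi ξ) (φ.jetChart z)) ∘L φ.d (jetProj B z)

section Pointwise

variable {z : J1 B} (hz : jetProj B z ∈ φ.coord.source)
include hz

lemma BundleChart.dJet_inducedLift (v : TangentSpace 𝓘(ℝ, Base m) (jetProj B z)) :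
    φ.dJet z (φ.inducedLift ξ z v) = modelLift (φ.jetChart z).2 (φ.xi ξ (φ.jetChart z))
      (fibreDeriv (φ.xi ξ) (φ.jetChart z)) (φ.d _ v) :=
  φ.dJet_jetVec hz _

lemma BundleChart.dJet_vertProj (w : TJ z) :
    φ.dJet z (ξ.vertProj z w) = φ.dJet z w -
      (φ.dJet z w).1.1 • ((1, (φ.jetChart z).2), φ.xi ξ (φ.jetChart z)) := by
  rw [HolonomicConnection.vertProj, map_sub, map_smul, φ.dJet_field ξ hz, φ.dJet_fst_fst hz]

lemma BundleChart.inducedLift_dProj (w : TJ z) :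
    φ.inducedLift ξ z (dProj z w) = w - (((1 / 2 : ℝ) •
      (ξ.bracketEndo z (ξ.vertProj z w) + ξ.vertProj z w) : VJ z) : TJ z) := by
  apply φ.dJet_injective hz
  rw [φ.dJet_inducedLift ξ hz, φ.d_dProj hz, map_sub, Submodule.coe_smul, map_smul,
    Submodule.coe_add, map_add, ξ.isBracketEndo_bracketEndo.dJet_apply φ hz,
    φ.dJet_vertProj ξ hz, sub_half_smul_modelBracketEndo]

variable {φ} in
lemma BundleChart.inducedLift_eq {φ' : BundleChart B} (hz' : jetProj B z ∈ φ'.coord.source) :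
    φ.inducedLift ξ z = φ'.inducedLift ξ z := by
  ext1 v
  obtain ⟨w, rfl⟩ := φ.dProj_surjective hz v
  rw [φ.inducedLift_dProj ξ hz, φ'.inducedLift_dProj ξ hz']

lemma BundleChart.contDiffAt_fibreDeriv_xi :
    ContDiffAt ℝ ∞ (fibreDeriv (φ.xi ξ)) (φ.jetChart z) :=
  ((φ.contDiffAt_xi ξ hz).fderiv_right (by simp)).clm_comp contDiffAt_const

end Pointwise

/-- The dynamic connection `γ_ξ`. -/
def HolonomicConnection.toDynamic : DynamicConnection B where
  lift z := (bundleChartAt z).inducedLift ξ z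
  mfderiv_lift z v := by
    have hz := mem_bundleChartAt_source z
    apply (bundleChartAt z).d_injective hz
    exact ((bundleChartAt z).d_dProj hz _).trans
      (congrArg Prod.fst ((bundleChartAt z).dJet_inducedLift ξ hz v))
  smooth w₀ := by
    obtain ⟨φ, hz⟩ := exists_bundleChart B (jetProj B w₀.1)
    obtain ⟨h_base, h_components⟩ := (φ.contMDiffAt_iff_dJet hz).1 (contMDiffAt_id (x := w₀))
    have h_chart := (φ.contMDiffAt_jetChart hz).comp w₀ h_base
    have h_xi := (φ.contDiffAt_xi ξ hz).contMDiffAt.comp w₀ h_chart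
    have h_deriv := (φ.contDiffAt_fibreDeriv_xi ξ hz).contMDiffAt.comp w₀ h_chart
    have h_lift := contDiff_modelLift.contMDiff.contMDiffAt.comp w₀ <|
      (contDiff_snd.contMDiff.contMDiffAt.comp w₀ h_chart).prodMk_space <| h_xi.prodMk_space <|
        h_deriv.prodMk_space <| contDiff_fst.contMDiff.contMDiffAt.comp w₀ h_components
    refine (φ.contMDiffAt_iff_dJet hz).2 ⟨h_base, h_lift.congr_of_eventuallyEq ?_⟩
    filter_upwards [h_base.continuousAt.eventually (φ.eventually_mem_source hz)]
      with w (hw : jetProj B w.1 ∈ φ.coord.source)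
    rw [BundleChart.inducedLift_eq ξ (mem_bundleChartAt_source _) hw]
    exact (φ.dJet_inducedLift ξ hw _).trans (congrArg _ (φ.d_dProj hw w.2))

lemma HolonomicConnection.toDynamic_vertProj (z : J1 B) (w : TJ z) :
    ξ.toDynamic.vertProj z w = (((1 / 2 : ℝ) •
      (ξ.bracketEndo z (ξ.vertProj z w) + ξ.vertProj z w) : VJ z) : TJ z) := by
  have h_lift := (bundleChartAt z).inducedLift_dProj ξ (mem_bundleChartAt_source z) w
  exact (congrArg (w - ·) h_lift).trans (sub_sub_cancel _ _)

lemma BundleChart.dJet_lift_toDynamic {z : J1 B} (hz : jetProj B z ∈ φ.coord.source)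
    (v : TangentSpace 𝓘(ℝ, Base m) (jetProj B z)) :
    φ.dJet z (ξ.toDynamic.lift z v) = modelLift (φ.jetChart z).2 (φ.xi ξ (φ.jetChart z))
      (fibreDeriv (φ.xi ξ) (φ.jetChart z)) (φ.d _ v) := by
  rw [← φ.dJet_inducedLift ξ hz, ← BundleChart.inducedLift_eq ξ (mem_bundleChartAt_source z) hz]
  rfl

lemma DynamicConnection.toHolonomic_field (γ : DynamicConnection B) (z : J1 B) :
    γ.toHolonomic.field z = γ.lift z (vel z) :=
  one_smul ℝ (γ.lift z (vel z))

lemma HolonomicConnection.field_injective :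
    Function.Injective (HolonomicConnection.field (B := B)) := fun _ _ h =>
  Subtype.ext <| Connection.ext <| funext fun z =>
    ContinuousLinearMap.ext_ring (congrFun h z)

lemma HolonomicConnection.toHolonomic_toDynamic : ξ.toDynamic.toHolonomic = ξ := by
  refine HolonomicConnection.field_injective (funext fun z => ?_)
  obtain ⟨φ, hz⟩ := exists_bundleChart B (jetProj B z)
  apply φ.dJet_injective hz
  rw [DynamicConnection.toHolonomic_field, φ.dJet_lift_toDynamic ξ hz, φ.d_vel hz,
    φ.dJet_field ξ hz, modelLift_apply]
  simp

end InducedConnection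

section Components

variable (φ : BundleChart B) (ξ : HolonomicConnection B) (γ : DynamicConnection B)

/-- The components of a dynamic connection `γ` as functions of the coordinates, collected in the
linear map `(a, b) ↦ a γ_0 + b^j γ_j` (junk outside the range of the chart). -/
def BundleChart.gamma (x : Jet m) : Base m →L[ℝ] Fib m :=
  let z := φ.jetChart.symm x
  ContinuousLinearMap.snd ℝ (Base m) (Fib m) ∘L φ.dJet z ∘L γ.lift z ∘L dProj z ∘L φ.jetVec z ∘L
    ContinuousLinearMap.inl ℝ (Base m) (Fib m)

lemma BundleChart.gamma_apply (x : Jet m) (a : Base m) :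
    φ.gamma γ x a = (φ.dJet (φ.jetChart.symm x) (γ.lift _ (dProj _ (φ.jetVec _ (a, 0))))).2 :=
  rfl

lemma BundleChart.contDiffOn_gamma : ContDiffOn ℝ ∞ (φ.gamma γ) φ.jetChart.target := by
  refine contDiffOn_clm_apply.2 fun a x hx => ?_
  have hz : jetProj B (φ.jetChart.symm x) ∈ φ.coord.source := φ.jetChart.map_target hx
  have h_lift := γ.smooth.contMDiffAt.comp _ (φ.contMDiffAt_jetVec hz (a, 0))
  have h_rep := φ.contDiffAt_fieldRep hz h_lift
  rw [φ.jetChart.right_inv hx] at h_rep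
  refine h_rep.snd.contDiffWithinAt.congr_of_mem (fun y hy => ?_) hx
  have h := φ.fieldRep_jetChart (φ.jetChart.map_target hy)
    fun z => γ.lift z (dProj z (φ.jetVec z (a, 0)))
  rw [φ.jetChart.right_inv hy] at h
  exact congrArg Prod.snd h.symm

lemma BundleChart.dqt_eq_fibreDeriv_apply {G : Type*} [NormedAddCommGroup G] [NormedSpace ℝ G]
    {f : J1 B → ℝ} {g : Jet m → G} (L : G →L[ℝ] ℝ) {z : J1 B}
    (hz : jetProj B z ∈ φ.coord.source) (hg : DifferentiableAt ℝ g (φ.jetChart z))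
    (h : ∀ y, jetProj B y ∈ φ.coord.source → f y = L (g (φ.jetChart y))) (i : Fin m) :
    dqt φ i f z = L (fibreDeriv g (φ.jetChart z) (EuclideanSpace.single i 1)) := by
  have h_eq : f ∘ φ.jetChart.symm =ᶠ[𝓝 (φ.jetChart z)] L ∘ g := by
    filter_upwards [φ.jetChart.open_target.mem_nhds (φ.jetChart.map_source hz)] with x hx
    rw [Function.comp_apply, h _ (φ.jetChart.map_target hx), φ.jetChart.right_inv hx,
      Function.comp_apply]
  rw [dqt, h_eq.fderiv_eq, (L.hasFDerivAt.comp _ hg.hasFDerivAt).fderiv]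
  rfl

section Pointwise

variable {z : J1 B} (hz : jetProj B z ∈ φ.coord.source)
include hz

lemma BundleChart.xi_jetChart (i : Fin m) : φ.xi ξ (φ.jetChart z) i = xiComp φ ξ i z := by
  rw [BundleChart.xi, φ.fieldRep_jetChart hz]
  rfl

lemma BundleChart.dqt_xiComp (i j : Fin m) : dqt φ j (xiComp φ ξ i) z =
    fibreDeriv (φ.xi ξ) (φ.jetChart z) (EuclideanSpace.single j 1) i :=
  φ.dqt_eq_fibreDeriv_apply (EuclideanSpace.proj i) hz
    ((φ.contDiffAt_xi ξ hz).differentiableAt (by simp)) (fun _ hy => (φ.xi_jetChart ξ hy i).symm) j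

lemma BundleChart.fibreDeriv_xi_apply (y : Fib m) (i : Fin m) :
    fibreDeriv (φ.xi ξ) (φ.jetChart z) y i = ∑ j, y j * dqt φ j (xiComp φ ξ i) z := by
  simp only [apply_eq_sum_single _ y, WithLp.ofLp_sum, Finset.sum_apply, WithLp.ofLp_smul,
    Pi.smul_apply, smul_eq_mul, φ.dqt_xiComp ξ hz]

lemma BundleChart.dJet_lift (v : TangentSpace 𝓘(ℝ, Base m) (jetProj B z)) :
    φ.dJet z (γ.lift z v) = (φ.d _ v, φ.gamma γ (φ.jetChart z) (φ.d _ v)) := by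
  have h_vec : dProj z (φ.jetVec z (φ.d _ v, 0)) = v :=
    φ.d_injective hz (by rw [φ.d_dProj hz, φ.dJet_jetVec hz])
  refine Prod.ext ?_ ?_
  · rw [← φ.d_dProj hz]
    exact congrArg _ (γ.mfderiv_lift z v)
  · rw [φ.gamma_apply, φ.jetChart.left_inv hz, h_vec]

lemma BundleChart.gammaTime_eq (i : Fin m) :
    gammaTime φ γ i z = φ.gamma γ (φ.jetChart z) (1, 0) i := by
  rw [gammaTime, φ.dJet_lift γ hz, φ.d_coordVec hz]

lemma BundleChart.gammaSpace_eq (i j : Fin m) :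
    gammaSpace φ γ i j z = φ.gamma γ (φ.jetChart z) (0, EuclideanSpace.single j 1) i := by
  rw [gammaSpace, φ.dJet_lift γ hz, φ.d_coordVec hz]

lemma BundleChart.differentiableAt_gamma : DifferentiableAt ℝ (φ.gamma γ) (φ.jetChart z) :=
  ((φ.contDiffOn_gamma γ).contDiffAt (φ.jetChart.open_target.mem_nhds
    (φ.jetChart.map_source hz))).differentiableAt (by simp)

lemma BundleChart.gamma_toDynamic (a : Base m) :
    φ.gamma ξ.toDynamic (φ.jetChart z) a = a.1 • φ.xi ξ (φ.jetChart z) +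
      (1 / 2 : ℝ) • fibreDeriv (φ.xi ξ) (φ.jetChart z) (a.2 - a.1 • (φ.jetChart z).2) := by
  have h := φ.dJet_lift_toDynamic ξ hz (coordVec φ _ a)
  rw [φ.dJet_lift _ hz, φ.d_coordVec hz] at h
  exact congrArg Prod.snd h

lemma BundleChart.gammaTime_toDynamic (i : Fin m) :
    gammaTime φ ξ.toDynamic i z = xiComp φ ξ i z -
      (1 / 2) * ∑ j, qt φ j z * dqt φ j (xiComp φ ξ i) z := by
  rw [φ.gammaTime_eq _ hz, φ.gamma_toDynamic ξ hz]
  simp only [one_smul, zero_sub, map_neg, smul_neg, PiLp.add_apply, PiLp.neg_apply,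
    PiLp.smul_apply, smul_eq_mul, φ.xi_jetChart ξ hz, φ.fibreDeriv_xi_apply ξ hz]
  rfl

lemma BundleChart.gammaSpace_toDynamic (i j : Fin m) :
    gammaSpace φ ξ.toDynamic i j z = (1 / 2) * dqt φ j (xiComp φ ξ i) z := by
  rw [φ.gammaSpace_eq _ hz, φ.gamma_toDynamic ξ hz, φ.dqt_xiComp ξ hz]
  simp

lemma BundleChart.xi_toHolonomic :
    φ.xi γ.toHolonomic (φ.jetChart z) = φ.gamma γ (φ.jetChart z) (1, (φ.jetChart z).2) := by
  rw [BundleChart.xi, φ.fieldRep_jetChart hz, γ.toHolonomic_field, φ.dJet_lift γ hz, φ.d_vel hz]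

lemma BundleChart.fibreDeriv_xi_toHolonomic (y : Fib m) :
    fibreDeriv (φ.xi γ.toHolonomic) (φ.jetChart z) y =
      fibreDeriv (φ.gamma γ) (φ.jetChart z) y (1, (φ.jetChart z).2) +
        φ.gamma γ (φ.jetChart z) (0, y) := by
  have h_eq : φ.xi γ.toHolonomic =ᶠ[𝓝 (φ.jetChart z)] fun x => φ.gamma γ x (1, x.2) :=
    (φ.jetChart.eventually_nhds _ hz).2 <|
      (φ.eventually_mem_source hz).mono fun _ hy => φ.xi_toHolonomic γ hy
  have h_deriv := (φ.differentiableAt_gamma γ hz).hasFDerivAt.clm_apply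
    ((hasFDerivAt_const (1 : ℝ) (φ.jetChart z)).prodMk hasFDerivAt_snd)
  rw [fibreDeriv, h_eq.fderiv_eq, h_deriv.fderiv, add_comm]
  rfl

lemma BundleChart.dqt_gammaTime_add_sum (i k : Fin m) :
    dqt φ i (gammaTime φ γ k) z + ∑ j, qt φ j z * dqt φ i (gammaSpace φ γ k j) z =
      fibreDeriv (φ.gamma γ) (φ.jetChart z) (EuclideanSpace.single i 1)
        (1, (φ.jetChart z).2) k := by
  set D := fibreDeriv (φ.gamma γ) (φ.jetChart z) (EuclideanSpace.single i 1)
  have h_dqt {f : J1 B → ℝ} (a : Base m)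
      (h : ∀ y, jetProj B y ∈ φ.coord.source → f y = φ.gamma γ (φ.jetChart y) a k) :
      dqt φ i f z = D a k :=
    φ.dqt_eq_fibreDeriv_apply (EuclideanSpace.proj k ∘L ContinuousLinearMap.apply ℝ (Fib m) a) hz
      (φ.differentiableAt_gamma γ hz) h i
  have h_split : D (1, (φ.jetChart z).2) = D (1, 0) +
      ∑ j, qt φ j z • D (0, EuclideanSpace.single j 1) := by
    have h_sum := apply_eq_sum_single (D ∘L ContinuousLinearMap.inr ℝ ℝ (Fib m)) (φ.jetChart z).2
    refine Eq.trans ?_ (congrArg (D (1, 0) + ·) h_sum)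
    simp [← map_add]
  simp only [h_dqt _ fun _ hy => φ.gammaTime_eq γ hy k,
    fun j => h_dqt _ fun _ hy => φ.gammaSpace_eq γ hy k j, h_split, PiLp.add_apply,
    WithLp.ofLp_sum, Finset.sum_apply, WithLp.ofLp_smul, Pi.smul_apply, smul_eq_mul]

end Pointwise

lemma DynamicConnection.isSymmetric_iff : γ.IsSymmetric ↔
    ∀ (φ : BundleChart B) (z : J1 B), jetProj B z ∈ φ.coord.source → ∀ y : Fib m,
      φ.gamma γ (φ.jetChart z) (0, y) =
        (1 / 2 : ℝ) • fibreDeriv (φ.xi γ.toHolonomic) (φ.jetChart z) y := by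
  refine forall₃_congr fun φ z hz => ?_
  have h_half (y : Fib m) : φ.gamma γ (φ.jetChart z) (0, y) =
      (1 / 2 : ℝ) • fibreDeriv (φ.xi γ.toHolonomic) (φ.jetChart z) y ↔
      φ.gamma γ (φ.jetChart z) (0, y) =
        fibreDeriv (φ.gamma γ) (φ.jetChart z) y (1, (φ.jetChart z).2) := by
    rw [φ.fibreDeriv_xi_toHolonomic γ hz, one_div, eq_inv_smul_iff₀ two_ne_zero, two_smul,
      add_left_inj]
  simp only [h_half, φ.dqt_gammaTime_add_sum γ hz, φ.gammaSpace_eq γ hz]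
  refine ⟨fun h y => ?_, fun h i k => congrArg (· k) (h _)⟩
  let L : Fib m →L[ℝ] Fib m := φ.gamma γ (φ.jetChart z) ∘L ContinuousLinearMap.inr ℝ ℝ (Fib m)
  let R : Fib m →L[ℝ] Fib m := (fibreDeriv (φ.gamma γ) (φ.jetChart z)).flip (1, (φ.jetChart z).2)
  have h_single (i : Fin m) : L (EuclideanSpace.single i 1) = R (EuclideanSpace.single i 1) :=
    PiLp.ext (h i)
  change L y = R y
  rw [apply_eq_sum_single L, apply_eq_sum_single R]
  simp only [h_single]

lemma HolonomicConnection.toDynamic_isSymmetric : ξ.toDynamic.IsSymmetric := by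
  refine ξ.toDynamic.isSymmetric_iff.2 fun φ z hz y => ?_
  rw [ξ.toHolonomic_toDynamic, φ.gamma_toDynamic ξ hz]
  simp

lemma DynamicConnection.eq_toDynamic_toHolonomic_iff :
    γ = γ.toHolonomic.toDynamic ↔ γ.IsSymmetric := by
  refine ⟨fun h => h ▸ γ.toHolonomic.toDynamic_isSymmetric, fun h => ?_⟩
  refine Connection.ext (funext fun z => ContinuousLinearMap.ext fun v => ?_)
  obtain ⟨φ, hz⟩ := exists_bundleChart B (jetProj B z)
  apply φ.dJet_injective hz
  set a := φ.d _ v with ha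
  have h_split : a = a.1 • ((1, (φ.jetChart z).2) : Base m) + (0, a.2 - a.1 • (φ.jetChart z).2) :=
    Prod.ext (by simp) (by simp)
  rw [φ.dJet_lift_toDynamic _ hz, modelLift_apply, φ.dJet_lift γ hz, ← ha, φ.xi_toHolonomic γ hz,
    ← γ.isSymmetric_iff.1 h φ z hz, ← map_smul, ← map_add, ← h_split]

end Components

end TimeMech

end

theorem proposition4p2 {m : ℕ}
    {M : Type*} [TopologicalSpace M] [ChartedSpace (TimeMech.Fib m) M]
    [IsManifold 𝓘(ℝ, TimeMech.Fib m) ∞ M]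
    {Q : Type*} [TopologicalSpace Q] [ChartedSpace (TimeMech.Base m) Q]
    [IsManifold 𝓘(ℝ, TimeMech.Base m) ∞ Q]
    (B : TimeMech.TimeBundle m M Q) :
    ∃ G : TimeMech.HolonomicConnection B → TimeMech.DynamicConnection B,
      -- the components of `γ_ξ = G ξ` in all bundle coordinates
      (∀ (ξ : TimeMech.HolonomicConnection B) (φ : TimeMech.BundleChart B) (z : TimeMech.J1 B),
        TimeMech.jetProj B z ∈ φ.coord.source → ∀ i : Fin m,
          TimeMech.gammaTime φ (G ξ) i z = TimeMech.xiComp φ ξ i z -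
            (1 / 2) * ∑ j, TimeMech.qt φ j z * TimeMech.dqt φ j (TimeMech.xiComp φ ξ i) z ∧
          ∀ j : Fin m, TimeMech.gammaSpace φ (G ξ) i j z =
            (1 / 2) * TimeMech.dqt φ j (TimeMech.xiComp φ ξ i) z) ∧
      -- the global construction of `γ_ξ` from `I_ξ(u) = [ξ, v̂(u)] - v̂([ξ, u])`
      (∀ ξ : TimeMech.HolonomicConnection B,
        ∃ I : TimeMech.VerticalEndo B, TimeMech.IsBracketEndo ξ I ∧
          (∀ I' : TimeMech.VerticalEndo B, TimeMech.IsBracketEndo ξ I' → I' = I) ∧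
          ∀ (z : TimeMech.J1 B) (w : TimeMech.TJ z), (G ξ).vertProj z w =
            (((1 / 2 : ℝ) • (I z (ξ.vertProj z w) + ξ.vertProj z w) : TimeMech.VJ z) :
              TimeMech.TJ z)) ∧
      -- symmetry
      (∀ ξ : TimeMech.HolonomicConnection B, (G ξ).IsSymmetric) ∧
      ∀ γ : TimeMech.DynamicConnection B, γ = G γ.toHolonomic ↔ γ.IsSymmetric := by
  refine ⟨fun ξ => ξ.toDynamic, fun ξ φ z hz i => ?components, fun ξ => ?bracket,
    fun ξ => ξ.toDynamic_isSymmetric, fun γ => γ.eq_toDynamic_toHolonomic_iff⟩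
  case components => exact ⟨φ.gammaTime_toDynamic ξ hz i, φ.gammaSpace_toDynamic ξ hz i⟩
  case bracket =>
    exact ⟨ξ.bracketEndo, ξ.isBracketEndo_bracketEndo,
      fun _ hI => hI.unique ξ.isBracketEndo_bracketEndo, ξ.toDynamic_vertProj⟩
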